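/- Let $n>1$, $\tau\in\mathbb C$ with $\operatorname{Im}\tau>0$, and $c,u\in\mathbb C$. Put $\theta_{m,l}(u,\tau)=\sum_{\mu\in m+l\mathbb Z}e^{2\pi i(\mu u+\mu^2\tau/(2l))}$, $\theta(u)=\theta_{1/2,1}(u+\tfrac12,\tau)$ and $\theta_j(u)=\theta_{n/2-j,\,n}(u+\tfrac12,\tau)$, and let $\eta$ be the Dedekind eta function. Let $\varepsilon_1,\dots,\varepsilon_n$ be the standard basis of $\mathbb C^n$, $\bar\varepsilon_i=\varepsilon_i-\frac1n\sum_j\varepsilon_j$, let $\langle\cdot,\cdot\rangle$ be the standard symmetric bilinear form, $\mathbf h^*=(\sum_j\varepsilon_j)^\perp$, and $\lambda_{i,j}=\langle\lambda,\bar\varepsilon_i-\bar\varepsilon_j\rangle$. Let either $W=\mathbf h^*$ and $v_i=\bar\varepsilon_i$, or $W=\mathbb C^n$ and $v_i=\varepsilon_i$. All operators act on functions $f$ on $W$; $\partial_i$ is the derivative in the direction $v_i$, $\partial^J=\prod_{i\in J}\partial_i$, and $\Delta(\lambda)=\prod_{i<j}\theta(\lambda_{i,j})$. Difference operators. Put $\phi(u,\lambda)_{jk}=\theta_j(\frac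 un-\langle\lambda,\bar\varepsilon_k\rangle)/(\sqrt{-1}\,\eta(\tau))$ for $1\le j,k\le n$, let $\bar\phi(u,\lambda)=\phi(u,\lambda)^{-1}$ be the inverse matrix, and for $\hbar\in\mathbb C$ $$(L(u)^i_jf)(\lambda)=\sum_{k=1}^n\phi(u+c\hbar,\lambda)_{jk}\,\bar\phi(u,\lambda)_{ki}\,f(\lambda+\hbar v_k).$$ Let $M_d$ be the trace of the antisymmetrically fused L-operator, $$M_d=\sum_{i_1<\dots<i_d}\ \sum_{\sigma\in S_d}\operatorname{sgn}(\sigma)\,L(u)^{i_{\sigma(1)}}_{i_1}L(u-\hbar)^{i_{\sigma(2)}}_{i_2}\cdots L(u-(d-1)\hbar)^{i_{\sigma(d)}}_{i_d}\quad(0\le d\le n,\ M_0=\mathrm{id}),$$ and $\dot M_d=\dfrac{\theta(u)}{\theta(u+\frac{cd}{n}\hbar)}M_d$. Differential operators. For $c\neq0$ and $0\le m\le n$ let $$D[m]=\sum_{|I|=m}\ \sum_{J\subset I}\frac{\partial^J\Delta}{\Delta}\Big(-\frac nc\Big)^{|I\setminus J|}\partial^{I\setminus J},$$ and let $H$ be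 the elliptic Calogero–Moser operator $$H=\Delta^{c/n}\circ\Big(\sum_{i=1}^n\partial_i^2+2\,\frac cn\Big(\frac cn+1\Big)\sum_{i<j}(\log\theta)''(\lambda_{i,j})\Big)\circ\Delta^{-c/n},$$ where the powers of $\Delta$ are formed with any local holomorphic branch of $\log\Delta$. Assume $\theta(u)\ne0$, let $\lambda\in W$ with $\theta(\lambda_{i,j})\neq0$ for all $i\ne j$, and let $f$ be a function on $W$ that is holomorphic near $\lambda$. Then $\hbar\mapsto(\dot M_{k'}f)(\lambda)$ is holomorphic near $\hbar=0$ for $0\le k'\le n$, and: (1) if $c\ne0$, then for all $0\le k\le d\le n$ $$(D[d-k]f)(\lambda)=\frac{(-\frac nc)^d}{\binom{n-d+k}{k}}\sum_{k'=0}^d(-1)^{d-k'}\binom{n-k'}{n-d}\frac{(-\frac{ck'}n)^k}{k!}\,\frac{1}{(d-k)!}\,\partial_\hbar^{\,d-k}(\dot M_{k'}f)(\lambda)\Big|_{\hbar=0};$$ (2) local holomorphic branches of $\log\Delta$ near $\lambda$ exist and, for each of them, $$\frac{1}{\hbar^2}\Big(\big(-2\dot M_2+\dot M_1^2-2\dot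 M_1+n\big)f\Big)(\lambda)\ \longrightarrow\ (Hf)(\lambda)\qquad(\hbar\to0,\ \hbar\neq0).$$ -/

import Mathlib

open Complex Filter Topology

noncomputable section

namespace EllipticCM

/-- `θ_{m,l}(u,τ) = ∑_{μ ∈ m + lℤ} exp 2πi (μ u + μ² τ / (2l))`. -/
def thetaChar (m l u τ : ℂ) : ℂ :=
  ∑' k : ℤ, cexp (2 * Real.pi * I * ((m + l * k) * u + (m + l * k) ^ 2 / (2 * l) * τ))

/-- The Jacobi theta function `θ(u) = θ_{1/2,1}(u + 1/2, τ)` (odd, with simple zeros on `ℤ + ℤτ`). -/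
def theta (τ u : ℂ) : ℂ := thetaChar (1 / 2) 1 (u + 1 / 2) τ

/-- `θ_j(u) = θ_{n/2-j,n}(u + 1/2, τ)`. -/
def thetaLevel (n : ℕ) (τ : ℂ) (j : ℕ) (u : ℂ) : ℂ := thetaChar ((n : ℂ) / 2 - (j : ℂ)) n (u + 1 / 2) τ

/-- The weight space `𝔥*` of `sl_n(ℂ)`: the orthogonal complement of `∑ ε_i` in `ℂⁿ`. -/
def weightSpace (n : ℕ) : Submodule ℂ (EuclideanSpace ℂ (Fin n)) :=
  (Submodule.span ℂ {∑ i : Fin n, EuclideanSpace.single i (1 : ℂ)})ᗮ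

variable {n : ℕ} (W : Submodule ℂ (EuclideanSpace ℂ (Fin n)))

/-- The orthogonal projection of `ε_i` to `W`: it is `ε̄_i` for `W = 𝔥*`, and `ε_i` for `W = ℂⁿ`. -/
def dir (i : Fin n) : W := W.orthogonalProjectionOnto (EuclideanSpace.single i (1 : ℂ))

/-- `⟨x, ε̄_k⟩`, where `ε̄_k = ε_k - (1/n) ∑ ε_i`. -/
def pairBar (x : W) (k : Fin n) : ℂ :=
  (x : EuclideanSpace ℂ (Fin n)) k - (∑ i, (x : EuclideanSpace ℂ (Fin n)) i) / n

/-- `x_{i,j} = ⟨x, ε̄_i - ε̄_j⟩`. -/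
def diffBar (x : W) (i j : Fin n) : ℂ := pairBar W x i - pairBar W x j

/-- The matrix of outgoing intertwining vectors: the entry in row `j` and column `k` is
`φ(u)^{x + ħ ε̄_k}_{x, j} = θ_j(u/n - ⟨x, ε̄_k⟩) / (√-1 η(τ))`, the labels `j = 1, …, n` being
represented by `Fin n`. -/
def outVec (τ u : ℂ) (x : W) : Matrix (Fin n) (Fin n) ℂ :=
  Matrix.of fun j k => thetaLevel n τ ((j : ℕ) + 1) (u / n - pairBar W x k) / (I * ModularForm.eta τ)

/-- The incoming intertwining vectors: the entry in row `k` and column `j` is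
`φ̄(u)^{x + ħ ε̄_k, j}_x`. -/
def inVec (τ u : ℂ) (x : W) : Matrix (Fin n) (Fin n) ℂ := (outVec W τ u x)⁻¹

/-- The matrix element `L(c|u)^i_j` of the factorized L-operator with step `h`. -/
def Lop (τ c h u : ℂ) (i j : Fin n) (f : W → ℂ) : W → ℂ := fun x =>
  ∑ k, outVec W τ (u + c * h) x j k * inVec W τ u x k i * f (x + h • dir W k)

/-- The matrix element `L(c|1^d_u)^I_{I'}` of the antisymmetrically fused L-operator, where
`I = {a 0 < ⋯ < a (d-1)}` and `I' = {b 0 < ⋯ < b (d-1)}`: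
`∑_σ sgn σ L(c|u)^{a (σ 0)}_{b 0} ∘ L(c|u-h)^{a (σ 1)}_{b 1} ∘ ⋯ ∘ L(c|u-(d-1)h)^{a (σ (d-1))}_{b (d-1)}`. -/
def fusedL (τ c h u : ℂ) {d : ℕ} (a b : Fin d → Fin n) (f : W → ℂ) : W → ℂ := fun x =>
  ∑ σ : Equiv.Perm (Fin d), ((Equiv.Perm.sign σ : ℤ) : ℂ) *
    (List.finRange d).foldr (fun (r : Fin d) g => Lop W τ c h (u - ((r : ℕ) : ℂ) * h) (a (σ r)) (b r) g) f x

/-- `M_d(c|u)`, the trace of the fused L-operator; `M_0 = id`. -/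
def M (τ c h u : ℂ) (d : ℕ) (f : W → ℂ) : W → ℂ := fun x =>
  ∑ S : {S : Finset (Fin n) // S.card = d},
    fusedL W τ c h u (S.1.orderEmbOfFin S.2) (S.1.orderEmbOfFin S.2) f x

/-- `Ṁ_d = θ(u) / θ(u + c d h / n) M_d(c|u)`. -/
def Mdot (τ c h u : ℂ) (d : ℕ) (f : W → ℂ) : W → ℂ := fun x =>
  theta τ u / theta τ (u + c * d / n * h) * M W τ c h u d f x

/-- `∂_i`, the derivative in the direction `dir W i`. -/
def pd (i : Fin n) (f : W → ℂ) : W → ℂ := fun x => lineDeriv ℂ f x (dir W i)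

/-- `∂^S = ∏_{i ∈ S} ∂_i`. -/
def pdSet (S : Finset (Fin n)) (f : W → ℂ) : W → ℂ := S.sort.foldr (fun i g => pd W i g) f

/-- `Δ(x) = ∏_{i<j} θ(x_{i,j})`. -/
def Delta (τ : ℂ) : W → ℂ := fun x =>
  ∏ i : Fin n, ∏ j ∈ Finset.Ioi i, theta τ (diffBar W x i j)

/-- `D[m] = ∑_{|S|=m} ∑_{J ⊆ S} (∂^J Δ / Δ) (-(n/c) ∂)^{S \ J}`. -/
def Dop (τ c : ℂ) (m : ℕ) (f : W → ℂ) : W → ℂ := fun x =>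
  ∑ S ∈ Finset.powersetCard m (Finset.univ : Finset (Fin n)), ∑ J ∈ S.powerset,
    pdSet W J (Delta W τ) x / Delta W τ x * ((-(n / c)) ^ (S \ J).card * pdSet W (S \ J) f x)

/-- `l` is a holomorphic branch of `log Δ` near `x`. -/
def IsLogDelta (τ : ℂ) (l : W → ℂ) (x : W) : Prop :=
  AnalyticAt ℂ l x ∧ ∀ᶠ y in 𝓝 x, cexp (l y) = Delta W τ y

/-- The elliptic Calogero–Moser operator
`Δ^{g} ∘ (∑ ∂_i² + 2 g (g + 1) ∑_{i<j} (log θ)''(x_{i,j})) ∘ Δ^{-g}`, `g = c/n`,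
the powers of `Δ` being taken with the branch `l` of `log Δ`. -/
def Hop (τ c : ℂ) (l : W → ℂ) (f : W → ℂ) : W → ℂ := fun x =>
  let F : W → ℂ := fun y => cexp (-(c / n) * l y) * f y
  cexp (c / n * l x) *
    (∑ i, pd W i (pd W i F) x +
      2 * (c / n) * (c / n + 1) *
        (∑ i : Fin n, ∑ j ∈ Finset.Ioi i, deriv (logDeriv (theta τ)) (diffBar W x i j)) * F x)

end EllipticCM

end

noncomputable section

namespace EllipticCM

/-! ### Theta functions of level `n` and the elliptic Vandermonde determinant. -/

section

/-! ### Theta functions with characteristics -/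

/-! Everything rests on an explicit form of the operators (`Mdot_eq_sum`), valid for small `ħ`: `Ṁ_d
f (λ) = ∑_{|K|=d} Δ(λ - (cħ/n) v_K) / Δ(λ) · f(λ + ħ v_K)`, where `v_K = ∑_{i ∈ K} v_i`.

Composing L-operators sums over paths `λ, λ + ħ v_{k 0}, …`. A column of the matrix of intertwining
vectors not yet visited by the path is unchanged when `u` drops by `ħ` at each step (`outVec_path`).
The antisymmetrized product of inverse matrices along a path is therefore a minor of the single
matrix `A⁻¹`, `A = φ(u, λ)`, and is zero for paths with repetition (`det_inv_rows_of_eq_columns`).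
With `B = φ(u + cħ, λ)`, Cauchy–Binet turns the trace into principal minors of `A⁻¹ B`, which are
ratios of determinants of theta functions (`M_eq_sum_det`). Such a determinant, as a function of one
of its points, is proportional to `θ(∑ z) ∏ θ(z_j - z_i)`, because a theta function of level `n` is
determined by its values at `n` points in general position (`det_thetaMatrix_shift`).

For (1), the sum is a restriction of `F(p, q) = Δ(p) f(q)` to lines through `(λ, λ)`: the `m`-th
`ħ`-derivative is `Δ(λ)⁻¹ ∑_K T(ξ_K, …, ξ_K)` with `T` the symmetric `m`-th derivative of `F`, `ξ_i
= (-(c/n) v_i, v_i)` and `ξ_K = ∑_{i ∈ K} ξ_i`. The alternating sum over `k'` is an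
inclusion–exclusion that keeps only the products of distinct `ξ_i` (`sum_multilinear_partialSums`),
and the Leibniz rule identifies these with `D[m]` (`Dop_eq_sum_iteratedFDeriv`).

For (2), put `Δ = e^l` and compare second order jets in `ħ`. Orders 0 and 1 cancel. At order 2 the
mixed second derivatives of `l` appear; they sum to the potential since `Δ` depends only on
differences of coordinates (`sum_ne_fderiv_fderiv_logDelta`). -/

lemma thetaChar_eq_jacobiTheta₂ (m : ℂ) {l : ℂ} (hl : l ≠ 0) (u τ : ℂ) :
    thetaChar m l u τ =
      cexp (2 * Real.pi * I * (m * u + m ^ 2 / (2 * l) * τ)) *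
        jacobiTheta₂ (l * u + m * τ) (l * τ) := by
  rw [thetaChar, jacobiTheta₂, ← tsum_mul_left]
  congr 1; ext k
  rw [jacobiTheta₂_term, ← Complex.exp_add]
  congr 1
  field_simp
  ring

lemma differentiable_thetaChar (m : ℂ) {n : ℕ} (hn : n ≠ 0) {τ : ℂ} (hτ : 0 < τ.im) :
    Differentiable ℂ fun u => thetaChar m n u τ := by
  have hn' : (n : ℂ) ≠ 0 := by exact_mod_cast hn
  have hτ' : 0 < ((n : ℂ) * τ).im := by
    have : 0 < (n : ℝ) := by exact_mod_cast Nat.pos_of_ne_zero hn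
    simpa using mul_pos this hτ
  simp_rw [thetaChar_eq_jacobiTheta₂ m hn']
  intro u
  refine DifferentiableAt.mul (by fun_prop) ?_
  exact (differentiableAt_jacobiTheta₂_fst _ hτ').comp u
    (f := fun u => (n : ℂ) * u + m * τ) (by fun_prop)

lemma exp_pi_mul_I_mul_nat (n : ℕ) : cexp (n * (Real.pi * I)) = (-1) ^ n := by
  rw [Complex.exp_nat_mul, Complex.exp_pi_mul_I]

lemma thetaLevel_add_one (n : ℕ) (τ : ℂ) (j : ℕ) (u : ℂ) :
    thetaLevel n τ j (u + 1) = (-1) ^ n * thetaLevel n τ j u := by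
  rw [thetaLevel, thetaLevel, thetaChar, thetaChar, ← tsum_mul_left]
  congr 1; ext k
  rw [← exp_pi_mul_I_mul_nat, ← Complex.exp_add, Complex.exp_eq_exp_iff_exists_int]
  exact ⟨n * k - j, by push_cast; ring⟩

lemma thetaLevel_add_inv {n : ℕ} (hn : n ≠ 0) (τ : ℂ) (j : ℕ) (u : ℂ) :
    thetaLevel n τ j (u + 1 / n) =
      cexp (2 * Real.pi * I * (1 / 2 - j / n)) * thetaLevel n τ j u := by
  have hn' : (n : ℂ) ≠ 0 := by exact_mod_cast hn
  rw [thetaLevel, thetaLevel, thetaChar, thetaChar, ← tsum_mul_left]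
  congr 1; ext k
  rw [← Complex.exp_add, Complex.exp_eq_exp_iff_exists_int]
  exact ⟨k, by field_simp; ring⟩

lemma thetaLevel_add_tau {n : ℕ} (hn : n ≠ 0) (τ : ℂ) (j : ℕ) (u : ℂ) :
    thetaLevel n τ j (u + τ) =
      (-1) ^ n * cexp (-(2 * Real.pi * I * (n * u + n * τ / 2))) * thetaLevel n τ j u := by
  have hn' : (n : ℂ) ≠ 0 := by exact_mod_cast hn
  rw [thetaLevel, thetaLevel, thetaChar, thetaChar, ← tsum_mul_left,
    ← (Equiv.addRight (1 : ℤ)).tsum_eq (fun k : ℤ => (-1) ^ n *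
      cexp (-(2 * Real.pi * I * (n * u + n * τ / 2))) * _)]
  congr 1; ext k
  rw [← exp_pi_mul_I_mul_nat, ← Complex.exp_add, ← Complex.exp_add,
    Complex.exp_eq_exp_iff_exists_int]
  refine ⟨-n, ?_⟩
  simp only [Equiv.coe_addRight]
  push_cast
  field_simp
  ring

lemma theta_eq_thetaLevel (τ : ℂ) : theta τ = thetaLevel 1 τ 0 := by
  ext u; simp [theta, thetaLevel]

lemma differentiable_theta {τ : ℂ} (hτ : 0 < τ.im) : Differentiable ℂ (theta τ) := by
  rw [theta_eq_thetaLevel]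
  exact (differentiable_thetaChar _ one_ne_zero hτ).comp (by fun_prop : Differentiable ℂ (· + _))

lemma theta_neg (τ u : ℂ) : theta τ (-u) = -theta τ u := by
  rw [theta, theta, thetaChar, thetaChar, ← tsum_neg,
    ← (Equiv.neg ℤ).tsum_eq, ← (Equiv.addRight (1 : ℤ)).tsum_eq]
  congr 1; ext k
  rw [← neg_one_mul (cexp _), ← Complex.exp_pi_mul_I, ← Complex.exp_add,
    Complex.exp_eq_exp_iff_exists_int]
  refine ⟨-(k + 1), ?_⟩
  simp only [Equiv.coe_addRight, Equiv.neg_apply]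
  push_cast
  ring

lemma theta_zero (τ : ℂ) : theta τ 0 = 0 := by
  have := theta_neg τ 0
  rw [neg_zero] at this
  linear_combination this / 2

lemma integral_cexp_int_mul (m : ℤ) :
    ∫ t in (0 : ℝ)..1, cexp (2 * Real.pi * I * m * t) = if m = 0 then 1 else 0 := by
  split_ifs with h
  · simp [h]
  · have h' : 2 * Real.pi * I * (m : ℂ) ≠ 0 := by
      have : (m : ℂ) ≠ 0 := by exact_mod_cast h
      simp [Real.pi_ne_zero, this]
    rw [integral_exp_mul_complex h']
    have : cexp (2 * Real.pi * I * m) = 1 := by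
      rw [Complex.exp_eq_one_iff]; exact ⟨m, by ring⟩
    simp [this]

/-- The constant Fourier coefficient of the theta series is its `k = 0` term. It serves to show that
the theta functions are not identically zero. -/
lemma integral_jacobiTheta₂ {τ : ℂ} (hτ : 0 < τ.im) :
    ∫ t in (0 : ℝ)..1, jacobiTheta₂ t τ = 1 := by
  have hs : HasSum (fun k : ℤ => ∫ t in (0 : ℝ)..1, jacobiTheta₂_term k t τ)
      (∫ t in (0 : ℝ)..1, jacobiTheta₂ t τ) := by
    refine intervalIntegral.hasSum_integral_of_dominated_convergence
      (fun k _ => Real.exp (-Real.pi * (τ.im * k ^ 2 - 2 * 0 * |k|))) (fun k => ?_)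
      (fun k => ?_) ?_ ?_ ?_
    · apply Continuous.aestronglyMeasurable
      unfold jacobiTheta₂_term; fun_prop
    · exact Eventually.of_forall fun t _ => norm_jacobiTheta₂_term_le hτ (by simp) le_rfl k
    · refine Eventually.of_forall fun t _ => ?_
      simpa using summable_pow_mul_jacobiTheta₂_term_bound 0 hτ 0
    · simp
    · exact Eventually.of_forall fun t _ => hasSum_jacobiTheta₂_term _ hτ
  have ht : ∀ k : ℤ, ∫ t in (0 : ℝ)..1, jacobiTheta₂_term k t τ = if k = 0 then 1 else 0 := by
    intro k
    simp_rw [jacobiTheta₂_term, Complex.exp_add]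
    rw [intervalIntegral.integral_mul_const, integral_cexp_int_mul]
    split_ifs with h <;> simp [h]
  simp_rw [ht] at hs
  exact hs.unique (hasSum_ite_eq 0 1)

lemma exists_thetaLevel_ne_zero {n : ℕ} (hn : n ≠ 0) {τ : ℂ} (hτ : 0 < τ.im) (j : ℕ) :
    ∃ u, thetaLevel n τ j u ≠ 0 := by
  have hn' : (n : ℂ) ≠ 0 := by exact_mod_cast hn
  have hτ' : 0 < ((n : ℂ) * τ).im := by
    have : 0 < (n : ℝ) := by exact_mod_cast Nat.pos_of_ne_zero hn
    simpa using mul_pos this hτ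
  by_contra! h
  have h0 : ∀ z, jacobiTheta₂ z (n * τ) = 0 := by
    intro z
    have := h ((z - ((n : ℂ) / 2 - j) * τ) / n - 1 / 2)
    rw [thetaLevel, thetaChar_eq_jacobiTheta₂ _ hn', mul_eq_zero] at this
    replace this := this.resolve_left (Complex.exp_ne_zero _)
    convert this using 2
    field_simp
    ring
  have := integral_jacobiTheta₂ hτ'
  simp [h0] at this

/-! ### The space of theta functions of a given level -/

/-- Entire functions with the quasi-periodicity of theta functions of level `n`. -/
def ThetaSpace (n : ℕ) (τ : ℂ) : Submodule ℂ (ℂ → ℂ) where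
  carrier := {g | Differentiable ℂ g ∧ (∀ z, g (z + 1) = (-1) ^ n * g z) ∧
    ∀ z, g (z + τ) = (-1) ^ n * cexp (-(2 * Real.pi * I * (n * z + n * τ / 2))) * g z}
  add_mem' := by
    rintro f g ⟨hf, hf1, hf2⟩ ⟨hg, hg1, hg2⟩
    refine ⟨hf.add hg, fun z => ?_, fun z => ?_⟩
    · simp only [Pi.add_apply, hf1, hg1]; ring
    · simp only [Pi.add_apply, hf2, hg2]; ring
  zero_mem' := ⟨differentiable_const 0, by simp, by simp⟩
  smul_mem' := by
    rintro a f ⟨hf, hf1, hf2⟩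
    refine ⟨hf.const_smul a, fun z => ?_, fun z => ?_⟩
    · simp only [Pi.smul_apply, smul_eq_mul, hf1]; ring
    · simp only [Pi.smul_apply, smul_eq_mul, hf2]; ring

lemma thetaLevel_mem_thetaSpace {n : ℕ} (hn : n ≠ 0) {τ : ℂ} (hτ : 0 < τ.im) (j : ℕ) :
    thetaLevel n τ j ∈ ThetaSpace n τ :=
  ⟨(differentiable_thetaChar _ hn hτ).comp (by fun_prop : Differentiable ℂ (· + _)),
    thetaLevel_add_one n τ j, thetaLevel_add_tau hn τ j⟩

/-- The integral over a period of an entire periodic function does not depend on the height. -/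
lemma integral_period_add {F : ℂ → ℂ} (hF : Differentiable ℂ F) (hp : ∀ z, F (z + 1) = F z)
    (w : ℂ) : ∫ t in (0 : ℝ)..1, F (t + w) = ∫ t in (0 : ℝ)..1, F t := by
  have hper : Function.Periodic (fun t : ℝ => F (t + w.im * I)) 1 := by
    intro t
    have := hp (t + w.im * I)
    dsimp only
    rw [← this]; congr 1; push_cast; ring
  have h1 : ∫ t in (0 : ℝ)..1, F (t + w) = ∫ t in (0 : ℝ)..1, F (t + w.im * I) := by
    have h := hper.intervalIntegral_add_eq w.re 0
    rw [zero_add, ← zero_add w.re, add_assoc, add_comm w.re 1, ← add_assoc, zero_add 1,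
      ← intervalIntegral.integral_comp_add_right (fun t : ℝ => F (t + w.im * I)) w.re] at h
    rw [← h]
    congr 1; ext t
    congr 1
    push_cast
    conv_lhs => rw [← Complex.re_add_im w]
    ring
  rw [h1]
  have h := Complex.integral_boundary_rect_eq_zero_of_differentiableOn F 0 (1 + w.im * I)
    hF.differentiableOn
  have hv : ∀ y : ℝ, F (1 + y * I) = F (y * I) := fun y => by rw [add_comm, hp]
  simp [hv] at h
  linear_combination -h

/-- The Fourier coefficient of index `n / 2 + m` of a function of level `n`. -/
def thetaCoeff (n : ℕ) (m : ℤ) (g : ℂ → ℂ) : ℂ :=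
  ∫ t in (0 : ℝ)..1, g t * cexp (-(2 * Real.pi * I * (n / 2 + m) * t))

lemma exists_thetaCoeff_eq_mul {n : ℕ} {τ : ℂ} {g : ℂ → ℂ} (hg : g ∈ ThetaSpace n τ) (m : ℤ) :
    ∃ a : ℂ, a ≠ 0 ∧ thetaCoeff n m g = a * thetaCoeff n (m + n) g := by
  obtain ⟨hd, h1, h2⟩ := hg
  -- Moving the path of integration from `[0, 1]` to `[τ, τ + 1]` and applying the quasi-periodicity
  -- in `τ` raises the index by `n`; this is the resulting factor.
  refine ⟨(-1) ^ n * cexp (-(2 * Real.pi * I * (n * τ / 2 + (n / 2 + m) * τ))), by simp, ?_⟩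
  have hp := integral_period_add (F := fun z => g z * cexp (-(2 * Real.pi * I * (n / 2 + m) * z)))
    (by fun_prop) ?_ τ
  · rw [thetaCoeff, thetaCoeff, ← hp, ← intervalIntegral.integral_const_mul]
    congr 1; ext t
    rw [h2]
    have : ∀ a b c d e f : ℂ, b * e = c * f → a * b * d * e = a * c * (d * f) := by
      intro a b c d e f h; linear_combination a * d * h
    apply this
    rw [← Complex.exp_add, ← Complex.exp_add]
    congr 1
    push_cast
    ring
  · intro z
    rw [h1, ← exp_pi_mul_I_mul_nat, mul_right_comm, ← Complex.exp_add, mul_comm]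
    congr 1
    rw [Complex.exp_eq_exp_iff_exists_int]
    exact ⟨-m, by push_cast; ring⟩

lemma eq_zero_of_thetaCoeff_eq_zero {n : ℕ} {τ : ℂ} {g : ℂ → ℂ} (hg : g ∈ ThetaSpace n τ)
    (h : ∀ m, thetaCoeff n m g = 0) : g = 0 := by
  obtain ⟨hd, h1, h2⟩ := hg
  -- For odd `n` the function is antiperiodic; the half-integral exponential makes it periodic, so
  -- that ordinary Fourier theory on the circle applies.
  have hper : Function.Periodic (fun t : ℝ => g t * cexp (-(Real.pi * I * n * t))) 1 := by
    intro t
    dsimp only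
    push_cast
    rw [h1, ← exp_pi_mul_I_mul_nat, mul_right_comm, ← Complex.exp_add, mul_comm]
    congr 2
    ring
  have hc : Continuous (fun t : ℝ => g t * cexp (-(Real.pi * I * n * t))) := by
    have := hd.continuous
    fun_prop
  have : Fact ((0 : ℝ) < 1) := ⟨one_pos⟩
  let G : C(AddCircle (1 : ℝ), ℂ) := ⟨hper.lift, continuous_coinduced_dom.mpr hc⟩
  have hG : ∀ t : ℝ, G t = g t * cexp (-(Real.pi * I * n * t)) := fun t => hper.lift_coe t
  have hz : ∀ m, fourierCoeff G m = 0 := by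
    intro m
    rw [fourierCoeff_eq_intervalIntegral G m 0, zero_add, ← h m, thetaCoeff]
    simp only [one_div, inv_one, one_smul]
    congr 1; ext t
    rw [hG, fourier_coe_apply, smul_eq_mul, mul_comm, mul_assoc, ← Complex.exp_add]
    congr 2
    push_cast
    ring
  have hsum := hasSum_fourier_series_of_summable (f := G) (by
    rw [show fourierCoeff G = fun _ => 0 from funext hz]; exact summable_zero)
  simp only [hz, zero_smul] at hsum
  have hG0 : G = 0 := hsum.unique hasSum_zero
  have hreal : ∀ t : ℝ, g t = 0 := by
    intro t
    have := hG t
    rw [hG0, ContinuousMap.zero_apply, eq_comm, mul_eq_zero] at this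
    exact this.resolve_right (Complex.exp_ne_zero _)
  -- An entire function vanishing on the real line is zero by the identity theorem.
  have han : AnalyticOnNhd ℂ g Set.univ := fun z _ => hd.analyticAt z
  have := han.eqOn_zero_of_preconnected_of_frequently_eq_zero isPreconnected_univ
    (Set.mem_univ (0 : ℂ)) ?_
  · ext z; exact this (Set.mem_univ z)
  · have ht : Tendsto (fun t : ℝ => (t : ℂ)) (𝓝[≠] 0) (𝓝[≠] 0) := by
      refine tendsto_nhdsWithin_iff.mpr ⟨?_, ?_⟩
      · have : Tendsto (fun t : ℝ => (t : ℂ)) (𝓝 0) (𝓝 ((0 : ℝ) : ℂ)) :=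
          Complex.continuous_ofReal.tendsto 0
        exact (by simpa using this : Tendsto _ (𝓝 (0 : ℝ)) (𝓝 (0 : ℂ))).mono_left
          nhdsWithin_le_nhds
      · filter_upwards [self_mem_nhdsWithin] with t ht
        simpa using ht
    exact ht.frequently (Frequently.of_forall hreal)

/-- A function of level `n` is determined by `n` consecutive Fourier coefficients. -/
lemma eq_zero_of_thetaCoeff_fin {n : ℕ} (hn : n ≠ 0) {τ : ℂ} {g : ℂ → ℂ}
    (hg : g ∈ ThetaSpace n τ) (h : ∀ m : Fin n, thetaCoeff n (m : ℕ) g = 0) : g = 0 := by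
  apply eq_zero_of_thetaCoeff_eq_zero hg
  have hstep : ∀ m : ℤ, thetaCoeff n m g = 0 ↔ thetaCoeff n (m + n) g = 0 := by
    intro m
    obtain ⟨a, ha, he⟩ := exists_thetaCoeff_eq_mul hg m
    rw [he]; simp [ha]
  have hmul : ∀ (q r : ℤ), thetaCoeff n r g = 0 ↔ thetaCoeff n (r + q * n) g = 0 := by
    intro q r
    induction q using Int.induction_on with
    | zero => simp
    | succ i ih => rw [ih, hstep, add_assoc, add_mul, one_mul]
    | pred i ih =>
      rw [ih, hstep (r + (-(i : ℤ) - 1) * n)]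
      ring_nf
  intro m
  have hn0 : (0 : ℤ) < n := by exact_mod_cast Nat.pos_of_ne_zero hn
  have hr := Int.emod_nonneg m hn0.ne'
  have hr' := Int.emod_lt_of_pos m hn0
  rw [← Int.emod_add_mul_ediv m n, mul_comm (n : ℤ), ← hmul]
  have := h ⟨(m % n).toNat, by omega⟩
  simpa [Int.toNat_of_nonneg hr] using this

/-! ### The Vandermonde product -/

/-- `θ(∑ z) ∏_{i<j} θ(z_j - z_i)`. -/
def thetaVand (n : ℕ) (τ : ℂ) (z : Fin n → ℂ) : ℂ :=
  theta τ (∑ i, z i) * ∏ i : Fin n, ∏ j ∈ Finset.Ioi i, theta τ (z j - z i)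

/-- Quasi-periodicity of level `N` and characteristic `a`. -/
def IsQuasiPeriodic (τ : ℂ) (N : ℕ) (a : ℂ) (g : ℂ → ℂ) : Prop :=
  Differentiable ℂ g ∧ (∀ z, g (z + 1) = (-1) ^ N * g z) ∧
    ∀ z, g (z + τ) = (-1) ^ N * cexp (-(2 * Real.pi * I * (N * z + a + N * τ / 2))) * g z

lemma isQuasiPeriodic_const (τ b : ℂ) : IsQuasiPeriodic τ 0 0 fun _ => b :=
  ⟨differentiable_const b, by simp, by simp⟩

lemma IsQuasiPeriodic.mul {τ : ℂ} {N N' : ℕ} {a a' : ℂ} {f g : ℂ → ℂ}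
    (hf : IsQuasiPeriodic τ N a f) (hg : IsQuasiPeriodic τ N' a' g) :
    IsQuasiPeriodic τ (N + N') (a + a') fun z => f z * g z := by
  refine ⟨hf.1.mul hg.1, fun z => ?_, fun z => ?_⟩
  · dsimp only
    rw [hf.2.1, hg.2.1]; ring
  · have : cexp (-(2 * Real.pi * I * ((N + N' : ℕ) * z + (a + a') + (N + N' : ℕ) * τ / 2))) =
        cexp (-(2 * Real.pi * I * (N * z + a + N * τ / 2))) *
          cexp (-(2 * Real.pi * I * (N' * z + a' + N' * τ / 2))) := by
      rw [← Complex.exp_add]; congr 1; push_cast; ring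
    dsimp only
    rw [hf.2.2, hg.2.2, this]; ring

lemma IsQuasiPeriodic.prod {ι : Type*} {τ : ℂ} (s : Finset ι) {N : ι → ℕ} {a : ι → ℂ}
    {f : ι → ℂ → ℂ} (hf : ∀ i ∈ s, IsQuasiPeriodic τ (N i) (a i) (f i)) :
    IsQuasiPeriodic τ (∑ i ∈ s, N i) (∑ i ∈ s, a i) fun z => ∏ i ∈ s, f i z := by
  classical
  induction s using Finset.induction_on with
  | empty => simpa using isQuasiPeriodic_const τ 1
  | insert i s hi ih =>
    simp only [Finset.sum_insert hi, Finset.prod_insert hi]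
    exact (hf i (Finset.mem_insert_self i s)).mul
      (ih fun j hj => hf j (Finset.mem_insert_of_mem hj))

lemma isQuasiPeriodic_theta_add {τ : ℂ} (hτ : 0 < τ.im) (b : ℂ) :
    IsQuasiPeriodic τ 1 b fun z => theta τ (z + b) := by
  refine ⟨(differentiable_theta hτ).comp (by fun_prop : Differentiable ℂ (· + b)),
    fun z => ?_, fun z => ?_⟩
  · dsimp only
    rw [add_right_comm, theta_eq_thetaLevel, thetaLevel_add_one]
  · dsimp only
    rw [add_right_comm z, theta_eq_thetaLevel, thetaLevel_add_tau one_ne_zero]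
    congr 3
    push_cast
    ring

lemma isQuasiPeriodic_theta_sub {τ : ℂ} (hτ : 0 < τ.im) (b : ℂ) :
    IsQuasiPeriodic τ 1 (-b) fun z => theta τ (b - z) := by
  have := (isQuasiPeriodic_const τ (-1)).mul (isQuasiPeriodic_theta_add hτ (-b))
  rw [zero_add, zero_add] at this
  convert this using 2 with z
  rw [← neg_sub, theta_neg, neg_one_mul, sub_eq_add_neg]

lemma sum_sum_Ioi_ite_add {M : Type*} [AddCommMonoid M] {n : ℕ} (l : Fin n) (f : Fin n → M) :
    ∑ i, ∑ j ∈ Finset.Ioi i, ((if i = l then f j else 0) + if j = l then f i else 0) =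
      ∑ i ∈ Finset.univ.erase l, f i := by
  simp_rw [Finset.sum_add_distrib, Finset.sum_ite_eq', Finset.mem_Ioi]
  have h1 : ∑ i, ∑ j ∈ Finset.Ioi i, (if i = l then f j else 0) = ∑ j ∈ Finset.Ioi l, f j := by
    rw [Finset.sum_eq_single l]
    · simp
    · intro i _ hi; simp [hi]
    · simp
  rw [h1, ← Finset.sum_filter, add_comm, ← Finset.sum_union]
  · apply Finset.sum_congr _ fun _ _ => rfl
    ext i
    simp [← lt_or_lt_iff_ne]
  · rw [Finset.disjoint_left]
    intro i hi hi'
    simp only [Finset.mem_filter, Finset.mem_Ioi] at hi hi'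
    exact lt_asymm hi.2 hi'

/-- One variable occurs in `n - 1` of the differences and once in the sum, which gives level `n`.
The characteristic of `θ(∑ z)` is the sum of the other points and cancels those of the differences:
this is why the factor `θ(∑ z)` is needed. -/
lemma thetaVand_update_mem {n : ℕ} {τ : ℂ} (hτ : 0 < τ.im) (w : Fin n → ℂ) (l : Fin n) :
    (fun y => thetaVand n τ (Function.update w l y)) ∈ ThetaSpace n τ := by
  have hfac : ∀ i j : Fin n, i < j → IsQuasiPeriodic τ
      ((if i = l then 1 else 0) + if j = l then 1 else 0)
      ((if i = l then -w j else 0) + if j = l then -w i else 0)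
      (fun y => theta τ (Function.update w l y j - Function.update w l y i)) := by
    intro i j hij
    by_cases hi : i = l
    · have hj : j ≠ l := fun h => hij.ne (hi.trans h.symm)
      simpa [hi, hj] using isQuasiPeriodic_theta_sub hτ (w j)
    · by_cases hj : j = l
      · simpa [hi, hj, sub_eq_add_neg] using isQuasiPeriodic_theta_add hτ (-w i)
      · simpa [hi, hj] using isQuasiPeriodic_const τ _
  have hprod := IsQuasiPeriodic.prod Finset.univ fun i _ =>
    IsQuasiPeriodic.prod (Finset.Ioi i) fun j hj => hfac i j (Finset.mem_Ioi.mp hj)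
  have hsum : IsQuasiPeriodic τ 1 (∑ i ∈ Finset.univ.erase l, w i)
      fun y => theta τ (∑ i, Function.update w l y i) := by
    convert isQuasiPeriodic_theta_add hτ (∑ i ∈ Finset.univ.erase l, w i) using 3 with y
    rw [← Finset.add_sum_erase _ _ (Finset.mem_univ l), Function.update_self]
    congr 1
    exact Finset.sum_congr rfl fun i hi => Function.update_of_ne (Finset.ne_of_mem_erase hi) _ _
  have h := hsum.mul hprod
  rw [sum_sum_Ioi_ite_add l fun _ => 1, sum_sum_Ioi_ite_add l fun i => -w i,
    Finset.sum_neg_distrib, add_neg_cancel, Finset.sum_const, Finset.card_erase_of_mem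
      (Finset.mem_univ l), Finset.card_univ, Fintype.card_fin, smul_eq_mul, mul_one] at h
  have hn : 1 + (n - 1) = n := by have := l.pos; omega
  rw [hn] at h
  simpa only [IsQuasiPeriodic, add_zero] using! h

lemma thetaVand_eq_zero_of_eq {n : ℕ} (τ : ℂ) {z : Fin n → ℂ} {i j : Fin n} (hij : i ≠ j)
    (h : z i = z j) : thetaVand n τ z = 0 := by
  wlog hlt : i < j generalizing i j
  · exact this hij.symm h.symm (lt_of_le_of_ne (not_lt.mp hlt) hij.symm)
  refine mul_eq_zero_of_right _ (Finset.prod_eq_zero (Finset.mem_univ i)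
    (Finset.prod_eq_zero (Finset.mem_Ioi.mpr hlt) ?_))
  rw [h, sub_self, theta_zero]

/-- A function of level `n` vanishing at `n` points in general position is zero. -/
lemma eq_zero_of_vanish_of_thetaVand_ne_zero {n : ℕ} (hn : n ≠ 0) {τ : ℂ} (hτ : 0 < τ.im)
    {w : Fin n → ℂ} (hw : thetaVand n τ w ≠ 0) {g : ℂ → ℂ} (hg : g ∈ ThetaSpace n τ)
    (h : ∀ k, g (w k) = 0) : g = 0 := by
  have hint : ∀ g ∈ ThetaSpace n τ, ∀ m : ℤ, IntervalIntegrable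
      (fun t : ℝ => g t * cexp (-(2 * Real.pi * I * (n / 2 + m) * t)))
      MeasureTheory.volume 0 1 := by
    intro g hg m
    have := hg.1.continuous
    exact Continuous.intervalIntegrable (by fun_prop) _ _
  let coeff : ThetaSpace n τ →ₗ[ℂ] (Fin n → ℂ) :=
    { toFun := fun g m => thetaCoeff n (m : ℕ) g
      map_add' := by
        intro f g
        ext m
        simp only [thetaCoeff, Submodule.coe_add, Pi.add_apply, add_mul]
        exact intervalIntegral.integral_add (hint f f.2 m) (hint g g.2 m)
      map_smul' := by
        intro a f
        ext m
        simp only [thetaCoeff, Submodule.coe_smul, Pi.smul_apply, smul_eq_mul, mul_assoc,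
          intervalIntegral.integral_const_mul, RingHom.id_apply] }
  have hcoeff : Function.Injective coeff := by
    rw [← LinearMap.ker_eq_bot, LinearMap.ker_eq_bot']
    intro f hf
    exact Subtype.ext (eq_zero_of_thetaCoeff_fin hn f.2 fun m => congrFun hf m)
  have : FiniteDimensional ℂ (ThetaSpace n τ) := FiniteDimensional.of_injective coeff hcoeff
  let ev : ThetaSpace n τ →ₗ[ℂ] (Fin n → ℂ) :=
    { toFun := fun g k => (g : ℂ → ℂ) (w k)
      map_add' := fun _ _ => rfl
      map_smul' := fun _ _ => rfl }
  -- Lagrange interpolation: letting the `k`-th point vary in `thetaVand` gives a function that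
  -- vanishes at every other `w l` but not at `w k`. Together with the bound by `n` Fourier
  -- coefficients, the dimension is exactly `n` and evaluation is bijective.
  have hev : Function.Surjective ev := by
    intro b
    refine ⟨∑ k, (b k / thetaVand n τ w) • ⟨_, thetaVand_update_mem hτ w k⟩, ?_⟩
    rw [map_sum]
    ext l
    simp only [map_smul, Finset.sum_apply, Pi.smul_apply]
    rw [Finset.sum_eq_single l]
    · change b l / _ * thetaVand n τ (Function.update w l (w l)) = b l
      rw [Function.update_eq_self, div_mul_cancel₀ _ hw]
    · intro k _ hkl
      change b k / _ * thetaVand n τ (Function.update w k (w l)) = 0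
      rw [thetaVand_eq_zero_of_eq τ (z := Function.update w k (w l)) hkl (by simp [hkl.symm]),
        mul_zero]
    · simp
  have hle := LinearMap.finrank_le_finrank_of_injective hcoeff
  have hge := LinearMap.finrank_le_finrank_of_surjective hev
  have hinj := (LinearMap.injective_iff_surjective_of_finrank_eq_finrank
    (le_antisymm hle hge)).mpr hev
  have := @hinj ⟨g, hg⟩ 0 (by ext k; exact h k)
  exact congrArg Subtype.val this

/-! ### The determinant of theta functions -/

/-- The matrix of the theta functions of level `n` at `n` points. -/
def thetaMatrix (n : ℕ) (τ : ℂ) (z : Fin n → ℂ) : Matrix (Fin n) (Fin n) ℂ :=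
  Matrix.of fun j k => thetaLevel n τ ((j : ℕ) + 1) (z k)

/-- The translation by `1/n` acts on these functions with pairwise distinct eigenvalues. -/
lemma linearIndependent_thetaLevel {n : ℕ} (hn : n ≠ 0) {τ : ℂ} (hτ : 0 < τ.im) :
    LinearIndependent ℂ fun j : Fin n => thetaLevel n τ ((j : ℕ) + 1) := by
  have hn' : (n : ℂ) ≠ 0 := by exact_mod_cast hn
  let T : Module.End ℂ (ℂ → ℂ) := LinearMap.funLeft ℂ ℂ (fun z => z + 1 / (n : ℂ))
  refine Module.End.eigenvectors_linearIndependent' T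
    (fun j : Fin n => cexp (2 * Real.pi * I * (1 / 2 - ((j : ℕ) + 1 : ℕ) / n))) ?_ _ ?_
  · intro i j hij
    dsimp only at hij
    rw [Complex.exp_eq_exp_iff_exists_int] at hij
    obtain ⟨m, hm⟩ := hij
    have hpi : (2 * Real.pi * I : ℂ) ≠ 0 := by simp [Real.pi_ne_zero]
    have h1 : (1 / 2 - (((i : ℕ) + 1 : ℕ) : ℂ) / n) = 1 / 2 - (((j : ℕ) + 1 : ℕ) : ℂ) / n + m := by
      apply mul_left_cancel₀ hpi
      rw [hm]; ring
    field_simp at h1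
    have h2 : ((j : ℕ) : ℤ) = (i : ℕ) + n * m := by
      have : (((j : ℕ) : ℤ) : ℂ) = (((i : ℕ) + n * m : ℤ) : ℂ) := by
        push_cast at h1 ⊢
        linear_combination h1 / 2
      exact_mod_cast this
    have hi := i.2
    have hj := j.2
    have h3 : ((j : ℕ) : ℤ) % n = ((i : ℕ) : ℤ) % n := by rw [h2]; simp
    rw [Int.emod_eq_of_lt (by omega) (by omega), Int.emod_eq_of_lt (by omega) (by omega)] at h3
    ext; omega
  · intro j
    rw [Module.End.hasEigenvector_iff, Module.End.mem_eigenspace_iff]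
    refine ⟨?_, ?_⟩
    · ext z
      exact thetaLevel_add_inv hn τ _ z
    · obtain ⟨z, hz⟩ := exists_thetaLevel_ne_zero hn hτ ((j : ℕ) + 1)
      intro h
      exact hz (congrFun h z)

/-- A left null vector would be a linear combination of the independent `θ_j` vanishing at all the
points, hence zero. -/
lemma det_thetaMatrix_ne_zero {n : ℕ} (hn : n ≠ 0) {τ : ℂ} (hτ : 0 < τ.im)
    {w : Fin n → ℂ} (hw : thetaVand n τ w ≠ 0) : (thetaMatrix n τ w).det ≠ 0 := by
  intro hdet
  obtain ⟨a, ha, h⟩ := Matrix.exists_vecMul_eq_zero_iff.mpr hdet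
  apply ha
  have hz : ∑ j, a j • thetaLevel n τ ((j : ℕ) + 1) = 0 := by
    apply eq_zero_of_vanish_of_thetaVand_ne_zero hn hτ hw
    · exact Submodule.sum_mem _ fun j _ => Submodule.smul_mem _ _
        (thetaLevel_mem_thetaSpace hn hτ _)
    · intro k
      have := congrFun h k
      simpa [Matrix.vecMul, dotProduct, thetaMatrix] using this
  ext j
  exact Fintype.linearIndependent_iff.mp (linearIndependent_thetaLevel hn hτ) a hz j

lemma det_thetaMatrix_update_mem {n : ℕ} (hn : n ≠ 0) {τ : ℂ} (hτ : 0 < τ.im)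
    (w : Fin n → ℂ) (l : Fin n) :
    (fun y => (thetaMatrix n τ (Function.update w l y)).det) ∈ ThetaSpace n τ := by
  have : (fun y => (thetaMatrix n τ (Function.update w l y)).det) =
      ∑ j, ((thetaMatrix n τ w).adjugate l j) • thetaLevel n τ ((j : ℕ) + 1) := by
    ext y
    have hupd : thetaMatrix n τ (Function.update w l y) = (thetaMatrix n τ w).updateCol l
        fun j => thetaLevel n τ ((j : ℕ) + 1) y := by
      ext j k
      by_cases hk : k = l
      · subst hk; simp [thetaMatrix]
      · simp [thetaMatrix, hk]
    rw [hupd, ← Matrix.cramer_apply, Matrix.cramer_eq_adjugate_mulVec]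
    simp [Matrix.mulVec, dotProduct]
  rw [this]
  exact Submodule.sum_mem _ fun j _ => Submodule.smul_mem _ _ (thetaLevel_mem_thetaSpace hn hτ _)

/-- As functions of `y` both sides have level `n`, vanish at the other points `w k`, and agree at `y
= w l`. -/
lemma det_thetaMatrix_update {n : ℕ} (hn : n ≠ 0) {τ : ℂ} (hτ : 0 < τ.im)
    {w : Fin n → ℂ} (hw : thetaVand n τ w ≠ 0) (l : Fin n) (y : ℂ) :
    (thetaMatrix n τ (Function.update w l y)).det =
      (thetaMatrix n τ w).det / thetaVand n τ w * thetaVand n τ (Function.update w l y) := by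
  have := eq_zero_of_vanish_of_thetaVand_ne_zero hn hτ hw
    (Submodule.sub_mem _ (det_thetaMatrix_update_mem hn hτ w l)
      (Submodule.smul_mem _ ((thetaMatrix n τ w).det / thetaVand n τ w)
        (thetaVand_update_mem hτ w l))) ?_
  · exact sub_eq_zero.mp (congrFun this y)
  · intro k
    simp only [Pi.sub_apply, Pi.smul_apply, smul_eq_mul]
    by_cases hk : k = l
    · subst hk
      rw [Function.update_eq_self, div_mul_cancel₀ _ hw, sub_self]
    · rw [thetaVand_eq_zero_of_eq τ (z := Function.update w l (w k)) hk (by simp [hk]), mul_zero,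
        sub_zero]
      refine Matrix.det_zero_of_column_eq hk fun j => ?_
      simp [thetaMatrix, hk]

/-- The ratio of determinants under a shift of some of the points, as long as the intermediate
configurations are in general position. -/
lemma det_thetaMatrix_shift {n : ℕ} (hn : n ≠ 0) {τ : ℂ} (hτ : 0 < τ.im) (z : Fin n → ℂ) (t : ℂ)
    (hz : ∀ K : Finset (Fin n), thetaVand n τ (fun k => z k + if k ∈ K then t else 0) ≠ 0)
    (K : Finset (Fin n)) :
    (thetaMatrix n τ (fun k => z k + if k ∈ K then t else 0)).det / (thetaMatrix n τ z).det =
      thetaVand n τ (fun k => z k + if k ∈ K then t else 0) / thetaVand n τ z := by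
  have h0 : thetaVand n τ z ≠ 0 := by simpa using hz ∅
  rw [div_eq_div_iff (det_thetaMatrix_ne_zero hn hτ h0) h0]
  -- The points are moved one at a time; each move needs the configuration before it to be in
  -- general position.
  induction K using Finset.induction_on with
  | empty => simp [mul_comm]
  | insert a K ha ih =>
    have hupd : (fun k => z k + if k ∈ insert a K then t else 0) =
        Function.update (fun k => z k + if k ∈ K then t else 0) a (z a + t) := by
      ext k
      by_cases hk : k = a
      · subst hk; simp
      · simp [hk]
    rw [hupd, det_thetaMatrix_update hn hτ (hz K)]
    have := hz K
    field_simp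
    linear_combination (thetaVand n τ (Function.update
      (fun k => z k + if k ∈ K then t else 0) a (z a + t))) * ih

end

/-! ### From the fused L-operator to an explicit difference operator. -/

section

/-! ### Minors -/

/-- An injective map is, uniquely, a permutation followed by the increasing enumeration of its
image. -/
lemma sum_injective_eq_sum_orderEmb {R : Type*} [AddCommMonoid R] {n d : ℕ}
    (F : (Fin d → Fin n) → R) :
    ∑ k : Fin d → Fin n with Function.Injective k, F k =
      ∑ S : {S : Finset (Fin n) // S.card = d}, ∑ π : Equiv.Perm (Fin d),
        F (S.1.orderEmbOfFin S.2 ∘ π) := by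
  classical
  rw [Finset.sum_sigma' Finset.univ (fun _ => Finset.univ)
    (fun (S : {S : Finset (Fin n) // S.card = d}) (π : Equiv.Perm (Fin d)) =>
      F (S.1.orderEmbOfFin S.2 ∘ π))]
  symm
  refine Finset.sum_bij (fun p _ => p.1.1.orderEmbOfFin p.1.2 ∘ p.2) ?_ ?_ ?_ fun _ _ => rfl
  · rintro ⟨S, π⟩ _
    simpa using (S.1.orderEmbOfFin S.2).injective.comp π.injective
  · rintro ⟨⟨S, hS⟩, π⟩ _ ⟨⟨S', hS'⟩, π'⟩ _ h
    dsimp only at h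
    have hSS : S = S' := by
      have h1 : Set.range (S.orderEmbOfFin hS ∘ π) = S := by
        rw [π.surjective.range_comp, Finset.range_orderEmbOfFin]
      have h2 : Set.range (S'.orderEmbOfFin hS' ∘ π') = S' := by
        rw [π'.surjective.range_comp, Finset.range_orderEmbOfFin]
      rw [h, h2] at h1
      exact_mod_cast h1.symm
    subst hSS
    have : π = π' := by
      ext i
      have := congrFun h i
      simpa [Fin.ext_iff] using this
    rw [this]
  · intro k hk
    have hk : Function.Injective k := by simpa using hk
    have hc : (Finset.univ.image k).card = d := by
      rw [Finset.card_image_of_injective _ hk, Finset.card_univ, Fintype.card_fin]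
    have hr : ∀ i, ∃ j, (Finset.univ.image k).orderEmbOfFin hc j = k i := by
      intro i
      have : k i ∈ Set.range ((Finset.univ.image k).orderEmbOfFin hc) := by
        rw [Finset.range_orderEmbOfFin]; simp
      exact this
    choose p hp using hr
    have hpi : Function.Injective p := by
      intro i j hij
      apply hk
      rw [← hp, ← hp, hij]
    refine ⟨⟨⟨_, hc⟩, Equiv.ofBijective p (Finite.injective_iff_bijective.mp hpi)⟩, by simp, ?_⟩
    ext i
    simp [hp]

/-- Dividing by the size of the fibre corrects for multiplicity, so a sum supported on the range of
`k` can be indexed by `k` even when `k` is not injective. -/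
lemma sum_eq_sum_div_card_fiber {ι κ : Type*} [Fintype ι] [Fintype κ] [DecidableEq ι]
    (k : κ → ι) (G : ι → ℂ) (hG : ∀ j, (∀ t, k t ≠ j) → G j = 0) :
    ∑ j, G j = ∑ t, G (k t) / ((Finset.univ.filter fun s => k s = k t).card : ℂ) := by
  rw [← Finset.sum_fiberwise Finset.univ k]
  refine Finset.sum_congr rfl fun j _ => ?_
  have : ∀ t ∈ Finset.univ.filter (fun t => k t = j),
      G (k t) / ((Finset.univ.filter fun s => k s = k t).card : ℂ) =
        G j / ((Finset.univ.filter fun s => k s = j).card : ℂ) := by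
    intro t ht
    rw [(Finset.mem_filter.mp ht).2]
  rw [Finset.sum_congr rfl this, Finset.sum_const, nsmul_eq_mul]
  by_cases h : (Finset.univ.filter fun s => k s = j).card = 0
  · rw [h, hG j]
    · simp
    · intro t ht
      rw [Finset.card_eq_zero, Finset.filter_eq_empty_iff] at h
      exact h (Finset.mem_univ t) ht
  · have : ((Finset.univ.filter fun s => k s = j).card : ℂ) ≠ 0 := by exact_mod_cast h
    field_simp

/-- If `A r` differs from `A` only in the columns `k s`, `s < r`, then the rows `k r` of the
inverses of `A r` are obtained from those of `A⁻¹` by a unitriangular transformation. -/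
lemma det_inv_rows_of_eq_columns {n d : ℕ} (A : Matrix (Fin n) (Fin n) ℂ)
    (B : Fin d → Matrix (Fin n) (Fin n) ℂ) (hA : IsUnit A.det) (hB : ∀ r, IsUnit (B r).det)
    (k a : Fin d → Fin n) (h : ∀ r j, (∀ s < r, k s ≠ j) → ∀ i, B r i j = A i j) :
    (Matrix.of fun r s => (B r)⁻¹ (k r) (a s)).det =
      if Function.Injective k then (Matrix.of fun r s => A⁻¹ (k r) (a s)).det else 0 := by
  classical
  -- In an unvisited column, `A` may be replaced by `B r`. So row `k r` of `(B r)⁻¹ * A` is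
  -- supported on the columns `k s`, `s ≤ r`, which expresses row `k r` of `(B r)⁻¹` through the
  -- rows `k s` of `A⁻¹`.
  have hγ : ∀ r j, (∀ s < r, k s ≠ j) → ((B r)⁻¹ * A) (k r) j = if k r = j then 1 else 0 := by
    intro r j hj
    have : ((B r)⁻¹ * A) (k r) j = ((B r)⁻¹ * B r) (k r) j := by
      simp only [Matrix.mul_apply]
      exact Finset.sum_congr rfl fun i _ => by rw [h r j hj i]
    rw [this, Matrix.nonsing_inv_mul _ (hB r), Matrix.one_apply]
  let C : Matrix (Fin d) (Fin d) ℂ := Matrix.of fun r t =>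
    ((B r)⁻¹ * A) (k r) (k t) / ((Finset.univ.filter fun s => k s = k t).card : ℂ)
  have hN : (Matrix.of fun r s => (B r)⁻¹ (k r) (a s)) =
      C * Matrix.of fun r s => A⁻¹ (k r) (a s) := by
    ext r s
    have h1 : (B r)⁻¹ = ((B r)⁻¹ * A) * A⁻¹ := by
      rw [Matrix.mul_assoc, Matrix.mul_nonsing_inv _ hA, Matrix.mul_one]
    rw [Matrix.of_apply, h1, Matrix.mul_apply, Matrix.mul_apply,
      sum_eq_sum_div_card_fiber k]
    · refine Finset.sum_congr rfl fun t _ => ?_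
      simp only [C, Matrix.of_apply]
      ring
    · intro j hj
      rw [hγ r j fun s _ => hj s, if_neg (hj r), zero_mul]
  rw [hN, Matrix.det_mul]
  split_ifs with hk
  · have hC : C.det = 1 := by
      have hfib : ∀ t, (Finset.univ.filter fun s => k s = k t).card = 1 := by
        intro t
        rw [Finset.card_eq_one]
        exact ⟨t, by ext s; simp [hk.eq_iff]⟩
      rw [Matrix.det_of_isLowerTriangular]
      · refine Finset.prod_eq_one fun r _ => ?_
        simp only [C, Matrix.of_apply, hfib]
        rw [hγ r (k r) fun s hs => hk.ne hs.ne]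
        simp
      · intro r t hrt
        have hrt : r < t := hrt
        simp only [C, Matrix.of_apply, hfib]
        rw [hγ r (k t) fun s hs => hk.ne (hs.trans hrt).ne, if_neg (hk.ne hrt.ne)]
        simp
    rw [hC, one_mul]
  -- The factorization also holds for a path with a repetition, and then its second factor has two
  -- equal rows.
  · simp only [Function.Injective, not_forall] at hk
    obtain ⟨r, s, hrs, hne⟩ := hk
    rw [Matrix.det_zero_of_row_eq hne (M := Matrix.of fun r s => A⁻¹ (k r) (a s)), mul_zero]
    ext t
    simp [hrs]

/-- A form of the Cauchy–Binet formula. -/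
lemma sum_prod_mul_det_eq_sum_minors {n d : ℕ} (P B : Matrix (Fin n) (Fin n) ℂ)
    (F : (Fin d → Fin n) → ℂ) (hF : ∀ k (π : Equiv.Perm (Fin d)), F (k ∘ π) = F k) :
    ∑ S : {S : Finset (Fin n) // S.card = d}, ∑ k : Fin d → Fin n with Function.Injective k,
        (∏ r, B (S.1.orderEmbOfFin S.2 r) (k r)) *
          (Matrix.of fun r s => P (k r) (S.1.orderEmbOfFin S.2 s)).det * F k =
      ∑ K : {S : Finset (Fin n) // S.card = d},
        ((P * B).submatrix (K.1.orderEmbOfFin K.2) (K.1.orderEmbOfFin K.2)).det *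
          F (K.1.orderEmbOfFin K.2) := by
  classical
  -- A permutation of `k` is traded for the inverse permutation of `a`, so the sum over `S` and `π`
  -- becomes one over all injective `a`.
  have hT : ∀ (a k : Fin d → Fin n) (π : Equiv.Perm (Fin d)),
      (∏ r, B (a r) ((k ∘ π) r)) * (Matrix.of fun r s => P ((k ∘ π) r) (a s)).det =
        (∏ r, B ((a ∘ (π⁻¹ : Equiv.Perm (Fin d))) r) (k r)) *
          (Matrix.of fun r s => P (k r) ((a ∘ (π⁻¹ : Equiv.Perm (Fin d))) s)).det := by
    intro a k π
    congr 1
    · rw [← Equiv.prod_comp π (fun r => B ((a ∘ (π⁻¹ : Equiv.Perm (Fin d))) r) (k r))]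
      simp
    · rw [← Matrix.det_submatrix_equiv_self π
        (Matrix.of fun r s => P (k r) ((a ∘ (π⁻¹ : Equiv.Perm (Fin d))) s))]
      congr 1
      ext r s
      simp
  simp_rw [sum_injective_eq_sum_orderEmb, hF, hT]
  rw [Finset.sum_comm]
  refine Finset.sum_congr rfl fun K _ => ?_
  simp_rw [← Finset.sum_mul]
  congr 1
  set e := K.1.orderEmbOfFin K.2
  have hinv : ∀ S : {S : Finset (Fin n) // S.card = d},
      ∑ π : Equiv.Perm (Fin d),
        (∏ r, B ((S.1.orderEmbOfFin S.2 ∘ (π⁻¹ : Equiv.Perm (Fin d))) r) (e r)) *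
          (Matrix.of fun r s =>
            P (e r) ((S.1.orderEmbOfFin S.2 ∘ (π⁻¹ : Equiv.Perm (Fin d))) s)).det =
      ∑ π : Equiv.Perm (Fin d), (∏ r, B ((S.1.orderEmbOfFin S.2 ∘ π) r) (e r)) *
          (Matrix.of fun r s => P (e r) ((S.1.orderEmbOfFin S.2 ∘ π) s)).det :=
    fun S => Equiv.sum_comp (Equiv.inv (Equiv.Perm (Fin d))) (fun π =>
      (∏ r, B ((S.1.orderEmbOfFin S.2 ∘ π) r) (e r)) *
          (Matrix.of fun r s => P (e r) ((S.1.orderEmbOfFin S.2 ∘ π) s)).det)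
  simp_rw [hinv]
  rw [← sum_injective_eq_sum_orderEmb fun a =>
    (∏ r, B (a r) (e r)) * (Matrix.of fun r s => P (e r) (a s)).det]
  -- Non-injective `a` give a determinant with two equal columns, so the restriction can be dropped
  -- and the product of sums expanded freely.
  rw [Finset.sum_filter_of_ne]
  · simp_rw [Matrix.det_apply', Finset.mul_sum]
    rw [Finset.sum_comm]
    refine Finset.sum_congr rfl fun σ _ => ?_
    simp only [Matrix.submatrix_apply, Matrix.mul_apply, Matrix.of_apply]
    rw [Finset.prod_univ_sum, Finset.mul_sum, Fintype.piFinset_univ]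
    refine Finset.sum_congr rfl fun a _ => ?_
    rw [Finset.prod_mul_distrib]
    ring
  · intro a _ ha
    by_contra hna
    simp only [Function.Injective, not_forall] at hna
    obtain ⟨r, s, hrs, hne⟩ := hna
    apply ha
    rw [Matrix.det_zero_of_column_eq hne, mul_zero]
    intro t
    simp [hrs]

/-- A principal minor of `A⁻¹ * B` as a ratio of determinants. -/
lemma det_submatrix_inv_mul {n d : ℕ} (A B : Matrix (Fin n) (Fin n) ℂ) (hA : IsUnit A.det)
    (K : Finset (Fin n)) (hK : K.card = d) :
    ((A⁻¹ * B).submatrix (K.orderEmbOfFin hK) (K.orderEmbOfFin hK)).det =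
      (Matrix.of fun i j => if j ∈ K then B i j else A i j).det / A.det := by
  set AK : Matrix (Fin n) (Fin n) ℂ := Matrix.of fun i j => if j ∈ K then B i j else A i j
  -- Outside `K` the columns of `A⁻¹ * AK` are those of the identity, so the matrix is block
  -- triangular and its determinant is the principal minor on `K`.
  have hcol : ∀ i j, (A⁻¹ * AK) i j = if j ∈ K then (A⁻¹ * B) i j else if i = j then 1 else 0 := by
    intro i j
    split_ifs with hj hij
    · simp [Matrix.mul_apply, AK, hj]
    · have : (A⁻¹ * AK) i j = (A⁻¹ * A) i j := by simp [Matrix.mul_apply, AK, hj]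
      rw [this, Matrix.nonsing_inv_mul _ hA, Matrix.one_apply, if_pos hij]
    · have : (A⁻¹ * AK) i j = (A⁻¹ * A) i j := by simp [Matrix.mul_apply, AK, hj]
      rw [this, Matrix.nonsing_inv_mul _ hA, Matrix.one_apply, if_neg hij]
  have hdet : (A⁻¹ * AK).det = AK.det / A.det := by
    rw [Matrix.det_mul, Matrix.det_nonsing_inv, Ring.inverse_eq_inv', div_eq_inv_mul]
  rw [← hdet, Matrix.twoBlockTriangular_det' (A⁻¹ * AK) (· ∈ K)]
  · have h1 : ((A⁻¹ * AK).toSquareBlockProp fun j => ¬ j ∈ K) = 1 := by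
      ext i j
      simp [Matrix.toSquareBlockProp_def, hcol, j.2, Matrix.one_apply, Subtype.ext_iff]
    rw [h1, Matrix.det_one, mul_one]
    let e : Fin d ≃ {j // j ∈ K} := (K.orderIsoOfFin hK).toEquiv
    trans (((A⁻¹ * AK).toSquareBlockProp fun j => j ∈ K).submatrix e e).det
    · congr 1
      ext i j
      change _ = (A⁻¹ * AK) (K.orderEmbOfFin hK i) (K.orderEmbOfFin hK j)
      rw [hcol, if_pos (K.orderEmbOfFin_mem hK j), Matrix.submatrix_apply]
    · convert Matrix.det_submatrix_equiv_self e ((A⁻¹ * AK).toSquareBlockProp fun j => j ∈ K)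
  · intro i hi j hj
    rw [hcol, if_neg hj, if_neg]
    rintro rfl
    exact hj hi

/-! ### Coordinates on the weight space -/

variable {n : ℕ} (W : Submodule ℂ (EuclideanSpace ℂ (Fin n)))

lemma pairBar_add_smul (x y : W) (h : ℂ) (k : Fin n) :
    pairBar W (x + h • y) k = pairBar W x k + h * pairBar W y k := by
  simp only [pairBar, Submodule.coe_add, Submodule.coe_smul, PiLp.add_apply, PiLp.smul_apply,
    smul_eq_mul, Finset.sum_add_distrib, ← Finset.mul_sum]
  ring

lemma pairBar_sum {ι : Type*} (s : Finset ι) (y : ι → W) (k : Fin n) :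
    pairBar W (∑ i ∈ s, y i) k = ∑ i ∈ s, pairBar W (y i) k := by
  classical
  induction s using Finset.induction_on with
  | empty => simp [pairBar]
  | insert i s hi ih =>
    rw [Finset.sum_insert hi, Finset.sum_insert hi, ← ih]
    simpa using pairBar_add_smul W (y i) (∑ i ∈ s, y i) 1 k

lemma sum_pairBar (hn : n ≠ 0) (x : W) : ∑ k, pairBar W x k = 0 := by
  have hn' : (n : ℂ) ≠ 0 := by exact_mod_cast hn
  simp only [pairBar, Finset.sum_sub_distrib, Finset.sum_const, Finset.card_univ,
    Fintype.card_fin, nsmul_eq_mul]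
  field_simp
  ring

variable {W}

/-- Pairing with `ε̄_k` ignores the component along `∑ ε_i`, so both choices of `W` give the same
numbers; `hW` enters the later arguments only through this. -/
lemma pairBar_dir (hn : n ≠ 0) (hW : W = weightSpace n ∨ W = ⊤) (i k : Fin n) :
    pairBar W (dir W i) k = (if i = k then 1 else 0) - 1 / n := by
  have hn' : (n : ℂ) ≠ 0 := by exact_mod_cast hn
  rcases hW with rfl | rfl
  · have hd : ((dir (weightSpace n) i : weightSpace n) : EuclideanSpace ℂ (Fin n)) =
        EuclideanSpace.single i 1 - (1 / n : ℂ) • ∑ i : Fin n, EuclideanSpace.single i (1 : ℂ) := by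
      refine Submodule.eq_starProjection_of_mem_orthogonal ?_ ?_
      · rw [weightSpace, Submodule.mem_orthogonal_singleton_iff_inner_right]
        have hS : ∀ k, (∑ i : Fin n, EuclideanSpace.single i (1 : ℂ)) k = 1 := by
          intro k; simp
        simp only [PiLp.inner_apply, PiLp.sub_apply, PiLp.smul_apply, hS]
        simp [hn']
      · rw [sub_sub_cancel]
        refine Submodule.smul_mem _ _ ?_
        exact Submodule.le_orthogonal_orthogonal _ (Submodule.mem_span_singleton_self _)
    have hc : ∀ k, ((dir (weightSpace n) i : weightSpace n) : EuclideanSpace ℂ (Fin n)) k =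
        (if i = k then 1 else 0) - 1 / n := by
      intro k
      rw [hd]
      simp [PiLp.single_apply, eq_comm]
    simp only [pairBar, hc, Finset.sum_sub_distrib, Finset.sum_ite_eq, Finset.mem_univ, if_true,
      Finset.sum_const, Finset.card_univ, Fintype.card_fin, nsmul_eq_mul]
    field_simp
    ring
  · have hd : ((dir ⊤ i : (⊤ : Submodule ℂ (EuclideanSpace ℂ (Fin n)))) :
        EuclideanSpace ℂ (Fin n)) = EuclideanSpace.single i 1 := by
      refine Submodule.eq_starProjection_of_mem_orthogonal trivial ?_
      simp
    simp [pairBar, hd, PiLp.single_apply, eq_comm]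

/-! ### The trace of the fused operator -/

lemma sum_fin_ite_lt {d r : ℕ} (hr : r ≤ d) : ∑ s : Fin d, (if (s : ℕ) < r then (1 : ℂ) else 0) = r := by
  rw [Finset.sum_boole, Fin.card_filter_val_lt, min_eq_right hr]

/-- Expansion over paths: the `r`-th factor is evaluated after the shifts by `dir W (k s)` for `s <
r`, the outermost operator shifting first. -/
lemma foldr_Lop (τ c h : ℂ) (f : W → ℂ) {d : ℕ} (U : Fin d → ℂ) (a b : Fin d → Fin n) (x : W) :
    (List.finRange d).foldr (fun (r : Fin d) g => Lop W τ c h (U r) (a r) (b r) g) f x =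
      ∑ k : Fin d → Fin n,
        (∏ r, outVec W τ (U r + c * h)
            (x + h • ∑ s : Fin d, if (s : ℕ) < r then dir W (k s) else 0) (b r) (k r) *
          inVec W τ (U r)
            (x + h • ∑ s : Fin d, if (s : ℕ) < r then dir W (k s) else 0) (k r) (a r)) *
          f (x + h • ∑ s, dir W (k s)) := by
  induction d generalizing x with
  | zero => simp
  | succ d ih =>
    rw [List.finRange_succ, List.foldr_cons, List.foldr_map, Lop,
      ← (Fin.consEquiv fun _ => Fin n).sum_comp, Fintype.sum_prod_type]
    refine Finset.sum_congr rfl fun k₀ _ => ?_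
    rw [ih (fun r => U r.succ) (fun r => a r.succ) (fun r => b r.succ), Finset.mul_sum]
    refine Finset.sum_congr rfl fun k _ => ?_
    simp only [Fin.consEquiv, Equiv.coe_fn_mk, Fin.prod_univ_succ, Fin.sum_univ_succ,
      Fin.cons_zero, Fin.cons_succ, Fin.val_zero, Fin.val_succ, Nat.not_lt_zero, if_false,
      Finset.sum_const_zero, add_zero, smul_zero, Nat.succ_pos, if_true, add_lt_add_iff_right,
      smul_add, add_assoc]
    ring

lemma outVec_eq (τ u : ℂ) (x : W) :
    outVec W τ u x = (I * ModularForm.eta τ)⁻¹ • thetaMatrix n τ fun k => u / n - pairBar W x k := by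
  ext j k
  simp [outVec, thetaMatrix, div_eq_inv_mul]

lemma pairBar_path (hn : n ≠ 0) (hW : W = weightSpace n ∨ W = ⊤) (h : ℂ) (x : W) {d : ℕ}
    (k : Fin d → Fin n) (r : Fin d) (j : Fin n) (hj : ∀ s < r, k s ≠ j) :
    pairBar W (x + h • ∑ s : Fin d, if (s : ℕ) < r then dir W (k s) else 0) j =
      pairBar W x j - (r : ℕ) * h / n := by
  have : ∑ s : Fin d, pairBar W (if (s : ℕ) < r then dir W (k s) else 0) j =
      ∑ s : Fin d, (if (s : ℕ) < r then (1 : ℂ) else 0) * (-1 / n) := by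
    refine Finset.sum_congr rfl fun s _ => ?_
    split_ifs with hs
    · rw [pairBar_dir hn hW, if_neg (hj s hs)]; ring
    · simp [pairBar]
  rw [pairBar_add_smul, pairBar_sum, this, ← Finset.sum_mul, sum_fin_ite_lt r.2.le]
  ring

/-- After `r` steps avoiding `j`, both `u/n` and the pairing with `ε̄_j` have decreased by `r h /
n`, so their difference is unchanged. This is why the fusion uses `u, u - ħ, …`. -/
lemma outVec_path (hn : n ≠ 0) (hW : W = weightSpace n ∨ W = ⊤) (τ u h : ℂ) (x : W) {d : ℕ}
    (k : Fin d → Fin n) (r : Fin d) (j : Fin n) (hj : ∀ s < r, k s ≠ j) (i : Fin n) :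
    outVec W τ (u - (r : ℕ) * h)
      (x + h • ∑ s : Fin d, if (s : ℕ) < r then dir W (k s) else 0) i j = outVec W τ u x i j := by
  simp only [outVec, Matrix.of_apply]
  rw [pairBar_path hn hW h x k r j hj]
  congr 2
  ring

lemma thetaVand_pairBar (hn : n ≠ 0) (τ u : ℂ) (x : W) :
    thetaVand n τ (fun k => u / n - pairBar W x k) = theta τ u * Delta W τ x := by
  have hn' : (n : ℂ) ≠ 0 := by exact_mod_cast hn
  rw [thetaVand, Delta, Finset.sum_sub_distrib, sum_pairBar W hn]
  congr 2
  · simp; field_simp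
  · ext i
    refine Finset.prod_congr rfl fun j _ => ?_
    rw [diffBar, sub_sub_sub_cancel_left]

/-- Adding `t` to the points in `K` raises their sum by `|K| t`, absorbed in `u`; the rest is the
translation of `x` by `-t ∑_{i ∈ K} v_i`. -/
lemma thetaVand_pairBar_shift (hn : n ≠ 0) (hW : W = weightSpace n ∨ W = ⊤) (τ u t : ℂ) (x : W)
    (K : Finset (Fin n)) :
    thetaVand n τ (fun k => u / n - pairBar W x k + if k ∈ K then t else 0) =
      theta τ (u + K.card * t) * Delta W τ (x - t • ∑ i ∈ K, dir W i) := by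
  have hn' : (n : ℂ) ≠ 0 := by exact_mod_cast hn
  rw [← thetaVand_pairBar hn]
  congr 1
  ext k
  rw [sub_eq_add_neg x, ← neg_smul, pairBar_add_smul, pairBar_sum]
  simp_rw [pairBar_dir hn hW]
  rw [Finset.sum_sub_distrib, Finset.sum_ite_eq']
  simp only [Finset.sum_const, nsmul_eq_mul]
  split_ifs <;> field_simp <;> ring

lemma isUnit_det_outVec (hn : n ≠ 0) {τ : ℂ} (hτ : 0 < τ.im) {u : ℂ} {x : W}
    (h : theta τ u * Delta W τ x ≠ 0) : IsUnit (outVec W τ u x).det := by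
  rw [← thetaVand_pairBar hn] at h
  rw [isUnit_iff_ne_zero, outVec_eq, Matrix.det_smul]
  refine mul_ne_zero (pow_ne_zero _ (inv_ne_zero (mul_ne_zero I_ne_zero ?_)))
    (det_thetaMatrix_ne_zero hn hτ h)
  exact ModularForm.eta_ne_zero hτ

/-- The trace of the fused operator in terms of determinants. -/
lemma M_eq_sum_det (hn : n ≠ 0) (hW : W = weightSpace n ∨ W = ⊤) {τ : ℂ} (hτ : 0 < τ.im)
    (c h u : ℂ) (d : ℕ) (f : W → ℂ) (x : W) (h0 : theta τ u * Delta W τ x ≠ 0)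
    (hpath : ∀ (k : Fin d → Fin n) (r : Fin d), theta τ (u - (r : ℕ) * h) *
      Delta W τ (x + h • ∑ s : Fin d, if (s : ℕ) < r then dir W (k s) else 0) ≠ 0) :
    M W τ c h u d f x = ∑ K : {S : Finset (Fin n) // S.card = d},
      (Matrix.of fun i j => if j ∈ K.1 then outVec W τ (u + c * h) x i j
        else outVec W τ u x i j).det / (outVec W τ u x).det *
          f (x + h • ∑ i ∈ K.1, dir W i) := by
  have hA := isUnit_det_outVec hn hτ h0
  have key : ∀ a b : Fin d → Fin n, fusedL W τ c h u a b f x =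
      ∑ k : Fin d → Fin n with Function.Injective k,
        (∏ r, outVec W τ (u + c * h) x (b r) (k r)) *
          (Matrix.of fun r s => (outVec W τ u x)⁻¹ (k r) (a s)).det *
            f (x + h • ∑ s, dir W (k s)) := by
    intro a b
    -- For a fixed path, `σ` enters only through the incoming vectors, whose signed sum is a
    -- determinant of rows of inverse matrices.
    have hdet : ∀ k : Fin d → Fin n, ∑ σ : Equiv.Perm (Fin d), ((Equiv.Perm.sign σ : ℤ) : ℂ) *
        ∏ r : Fin d, inVec W τ (u - (r : ℕ) * h)
          (x + h • ∑ s : Fin d, if (s : ℕ) < r then dir W (k s) else 0) (k r) (a (σ r)) =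
        if Function.Injective k then
          (Matrix.of fun r s => (outVec W τ u x)⁻¹ (k r) (a s)).det else 0 := by
      intro k
      rw [← det_inv_rows_of_eq_columns (outVec W τ u x) (fun r => outVec W τ (u - (r : ℕ) * h)
          (x + h • ∑ s : Fin d, if (s : ℕ) < r then dir W (k s) else 0)) hA
          (fun r => isUnit_det_outVec hn hτ (hpath k r)) k a
          (fun r j hj i => outVec_path hn hW τ u h x k r j hj i),
        ← Matrix.det_transpose, Matrix.det_apply']
      rfl
    simp only [fusedL]
    simp_rw [foldr_Lop τ c h f (fun r : Fin d => u - ((r : ℕ) : ℂ) * h), Finset.mul_sum]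
    rw [Finset.sum_comm, Finset.sum_filter]
    refine Finset.sum_congr rfl fun k _ => ?_
    have hsplit : ∀ σ : Equiv.Perm (Fin d), ((Equiv.Perm.sign σ : ℤ) : ℂ) *
        ((∏ r : Fin d, outVec W τ (u - (r : ℕ) * h + c * h)
            (x + h • ∑ s : Fin d, if (s : ℕ) < r then dir W (k s) else 0) (b r) (k r) *
          inVec W τ (u - (r : ℕ) * h)
            (x + h • ∑ s : Fin d, if (s : ℕ) < r then dir W (k s) else 0) (k r) (a (σ r))) *
          f (x + h • ∑ s, dir W (k s))) =
        (∏ r : Fin d, outVec W τ (u - (r : ℕ) * h + c * h)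
            (x + h • ∑ s : Fin d, if (s : ℕ) < r then dir W (k s) else 0) (b r) (k r)) *
          (((Equiv.Perm.sign σ : ℤ) : ℂ) * ∏ r : Fin d, inVec W τ (u - (r : ℕ) * h)
          (x + h • ∑ s : Fin d, if (s : ℕ) < r then dir W (k s) else 0) (k r) (a (σ r))) *
          f (x + h • ∑ s, dir W (k s)) := by
      intro σ
      rw [Finset.prod_mul_distrib]
      ring
    simp_rw [hsplit]
    rw [← Finset.sum_mul, ← Finset.mul_sum, hdet]
    split_ifs with hk
    · congr 2
      -- On an injective path column `k r` is still unvisited at step `r`, so the outgoing vectors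
      -- can be moved back to `x` as well.
      refine Finset.prod_congr rfl fun r _ => ?_
      rw [sub_add_eq_add_sub]
      exact outVec_path hn hW τ (u + c * h) h x k r (k r) (fun s hs => hk.ne hs.ne) (b r)
    · simp
  simp only [M, key]
  rw [sum_prod_mul_det_eq_sum_minors (outVec W τ u x)⁻¹ (outVec W τ (u + c * h) x)
    (fun k => f (x + h • ∑ s, dir W (k s)))
    (fun k π => by rw [← Equiv.sum_comp π fun s => dir W (k s)]; rfl)]
  refine Finset.sum_congr rfl fun K _ => ?_
  rw [det_submatrix_inv_mul _ _ hA]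
  congr 4
  rw [← Finset.sum_coe_sort K.1, ← (K.1.orderIsoOfFin K.2).toEquiv.sum_comp]
  rfl

/-- `Ṁ_d` as an explicit difference operator. -/
theorem Mdot_eq_sum (hn : n ≠ 0) (hW : W = weightSpace n ∨ W = ⊤) {τ : ℂ} (hτ : 0 < τ.im)
    (c h u : ℂ) (d : ℕ) (f : W → ℂ) (x : W)
    (hpath : ∀ (k : Fin d → Fin n) (r : Fin d), theta τ (u - (r : ℕ) * h) *
      Delta W τ (x + h • ∑ s : Fin d, if (s : ℕ) < r then dir W (k s) else 0) ≠ 0)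
    (hshift : ∀ K : Finset (Fin n), theta τ (u + K.card * (c / n * h)) *
      Delta W τ (x - (c / n * h) • ∑ i ∈ K, dir W i) ≠ 0) :
    Mdot W τ c h u d f x = ∑ K ∈ Finset.powersetCard d (Finset.univ : Finset (Fin n)),
      Delta W τ (x - (c / n * h) • ∑ i ∈ K, dir W i) / Delta W τ x *
        f (x + h • ∑ i ∈ K, dir W i) := by
  have h0 : theta τ u * Delta W τ x ≠ 0 := by simpa using hshift ∅
  have hη : I * ModularForm.eta τ ≠ 0 := mul_ne_zero I_ne_zero (ModularForm.eta_ne_zero hτ)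
  rw [Mdot, M_eq_sum_det hn hW hτ c h u d f x h0 hpath, Finset.mul_sum,
    Finset.sum_subtype (p := fun S : Finset (Fin n) => S.card = d) _ (by simp)]
  refine Finset.sum_congr rfl fun K _ => ?_
  have hmat : (Matrix.of fun i j => if j ∈ K.1 then outVec W τ (u + c * h) x i j
        else outVec W τ u x i j) = (I * ModularForm.eta τ)⁻¹ •
          thetaMatrix n τ fun k => u / n - pairBar W x k + if k ∈ K.1 then c / n * h else 0 := by
    ext i j
    by_cases hj : j ∈ K.1
    · simp [hj, outVec, thetaMatrix, div_eq_inv_mul]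
      left
      congr 1
      ring
    · simp [hj, outVec, thetaMatrix, div_eq_inv_mul]
  -- Replacing `u` by `u + c h` in the columns of `K` moves their points by `c h / n`. The ratio of
  -- Vandermonde products contains `θ(u + d c h / n) / θ(u)`, which the normalization of `Mdot`
  -- removes.
  have hsh := det_thetaMatrix_shift hn hτ (fun k => u / n - pairBar W x k) (c / n * h)
    (fun K => by rw [thetaVand_pairBar_shift hn hW]; exact hshift K) K.1
  rw [hmat, outVec_eq, Matrix.det_smul, Matrix.det_smul, mul_div_mul_left _ _
    (pow_ne_zero _ (inv_ne_zero hη)), hsh, thetaVand_pairBar_shift hn hW, thetaVand_pairBar hn, K.2]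
  have h1 : theta τ (u + d * (c / n * h)) ≠ 0 := by
    have := left_ne_zero_of_mul (hshift K.1)
    rwa [K.2] at this
  have h2 : u + c * d / n * h = u + d * (c / n * h) := by ring
  have h3 := left_ne_zero_of_mul h0
  have h4 := right_ne_zero_of_mul h0
  rw [h2]
  generalize theta τ (u + d * (c / n * h)) = t at h1 ⊢
  generalize Delta W τ (x - (c / n * h) • ∑ i ∈ K.1, dir W i) = D
  field_simp

end

/-! ### Taylor coefficients of the difference operators and the operators `D[m]`. -/

section

/-! ### Iterated directional derivatives -/

section Directional

variable {E : Type*} [NormedAddCommGroup E] [NormedSpace ℂ E]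

lemma differentiableAt_iteratedFDeriv {F : E → ℂ} {p : E} (hF : AnalyticAt ℂ F p) (m : ℕ) :
    DifferentiableAt ℂ (iteratedFDeriv ℂ m F) p :=
  ((hF.contDiffAt (n := ⊤)).iteratedFDeriv_right (m := 1) (i := m) le_top).differentiableAt
    one_ne_zero

lemma hasFDerivAt_iteratedFDeriv_apply {F : E → ℂ} {p : E} (hF : AnalyticAt ℂ F p) {m : ℕ}
    (v : Fin m → E) :
    HasFDerivAt (fun q => iteratedFDeriv ℂ m F q v)
      ((ContinuousMultilinearMap.apply ℂ (fun _ : Fin m => E) ℂ v).comp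
        (fderiv ℂ (iteratedFDeriv ℂ m F) p)) p :=
  (ContinuousMultilinearMap.apply ℂ (fun _ : Fin m => E) ℂ v).hasFDerivAt.comp p
    (differentiableAt_iteratedFDeriv hF m).hasFDerivAt

lemma iteratedDeriv_comp_line {F : E → ℂ} {p : E} (hF : AnalyticAt ℂ F p) (ξ : E) (m : ℕ) :
    iteratedDeriv m (fun h : ℂ => F (p + h • ξ)) 0 = iteratedFDeriv ℂ m F p fun _ => ξ := by
  have hline : Continuous fun h : ℂ => p + h • ξ := by fun_prop
  have hev : ∀ᶠ h : ℂ in 𝓝 0, AnalyticAt ℂ F (p + h • ξ) := by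
    have : Tendsto (fun h : ℂ => p + h • ξ) (𝓝 0) (𝓝 p) := by
      simpa using hline.tendsto 0
    exact this.eventually hF.eventually_analyticAt
  -- The induction differentiates the identity, so it must hold near `0` and not only at `0`.
  have key : ∀ᶠ h : ℂ in 𝓝 0, iteratedDeriv m (fun h : ℂ => F (p + h • ξ)) h =
      iteratedFDeriv ℂ m F (p + h • ξ) fun _ => ξ := by
    induction m with
    | zero => exact Eventually.of_forall fun h => by simp
    | succ m ih =>
      filter_upwards [hev, ih.eventually_nhds] with h hh hm
      rw [iteratedDeriv_succ, EventuallyEq.deriv_eq (f := fun h : ℂ =>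
        iteratedFDeriv ℂ m F (p + h • ξ) fun _ => ξ) hm]
      have h1 : HasDerivAt (fun h : ℂ => p + h • ξ) ξ h := by
        simpa using ((hasDerivAt_id h).smul_const ξ).const_add p
      have := (hasFDerivAt_iteratedFDeriv_apply hh fun _ : Fin m => ξ).comp_hasDerivAt h h1
      exact this.deriv
  simpa using key.self_of_nhds

/-- The iterated directional derivative along a list of vectors, the head being applied last. -/
def listDeriv (L : List E) (F : E → ℂ) : E → ℂ :=
  L.foldr (fun ξ G q => fderiv ℂ G q ξ) F

lemma iteratedFDeriv_eventuallyEq_listDeriv {F : E → ℂ} {p : E} (hF : AnalyticAt ℂ F p) {m : ℕ}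
    (v : Fin m → E) :
    (fun q => iteratedFDeriv ℂ m F q v) =ᶠ[𝓝 p] listDeriv (List.ofFn v) F := by
  induction m with
  | zero => exact Eventually.of_forall fun q => by simp [listDeriv]
  | succ m ih =>
    filter_upwards [hF.eventually_analyticAt, (ih fun i => v i.succ).eventually_nhds] with q hq hm
    rw [List.ofFn_succ, listDeriv, List.foldr_cons, ← listDeriv, ← EventuallyEq.fderiv_eq hm,
      (hasFDerivAt_iteratedFDeriv_apply hq fun i => v i.succ).fderiv, iteratedFDeriv_succ_apply_left]
    rfl

end Directional

variable {n : ℕ} {W : Submodule ℂ (EuclideanSpace ℂ (Fin n))}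

lemma pd_eventuallyEq_fderiv {f : W → ℂ} {x : W} (hf : AnalyticAt ℂ f x) (i : Fin n) :
    pd W i f =ᶠ[𝓝 x] fun y => fderiv ℂ f y (dir W i) := by
  filter_upwards [hf.eventually_analyticAt] with y hy
  exact hy.differentiableAt.lineDeriv_eq_fderiv

lemma analyticAt_pd {f : W → ℂ} {x : W} (hf : AnalyticAt ℂ f x) (i : Fin n) :
    AnalyticAt ℂ (pd W i f) x := by
  refine AnalyticAt.congr ?_ (pd_eventuallyEq_fderiv hf i).symm
  exact (ContinuousLinearMap.apply ℂ ℂ (dir W i)).analyticAt _ |>.comp hf.fderiv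

lemma pdSet_insert {a : Fin n} {S : Finset (Fin n)} (ha : ∀ b ∈ S, a < b) (f : W → ℂ) :
    pdSet W (insert a S) f = pd W a (pdSet W S f) := by
  rw [pdSet, Finset.sort_insert _ (fun b hb => (ha b hb).le) fun h => lt_irrefl _ (ha a h)]
  rfl

lemma analyticAt_pdSet {f : W → ℂ} {x : W} (hf : AnalyticAt ℂ f x) (S : Finset (Fin n)) :
    AnalyticAt ℂ (pdSet W S f) x := by
  induction S using Finset.induction_on_min with
  | empty => simpa [pdSet] using hf
  | insert a S ha ih =>
    rw [pdSet_insert ha]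
    exact analyticAt_pd ih a

/-- Leibniz rule: the derivative along `(t v_i, v_i)` falls either on `A`, with a factor `t`, or on
`B`; `J` records the indices that fall on `A`. Inserting minimal elements matches the order in which
`pdSet` composes its derivatives. -/
lemma listDeriv_mul_eventuallyEq {A B : W → ℂ} {x : W} (hA : AnalyticAt ℂ A x)
    (hB : AnalyticAt ℂ B x) (t : ℂ) (S : Finset (Fin n)) :
    listDeriv (S.sort.map fun i => (t • dir W i, dir W i)) (fun q : W × W => A q.1 * B q.2)
      =ᶠ[𝓝 (x, x)] fun q => ∑ J ∈ S.powerset,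
        t ^ J.card * pdSet W J A q.1 * pdSet W (S \ J) B q.2 := by
  induction S using Finset.induction_on_min with
  | empty => exact Eventually.of_forall fun q => by simp [listDeriv, pdSet]
  | insert a S ha ih =>
    have haS : a ∉ S := fun h => lt_irrefl _ (ha a h)
    rw [Finset.sort_insert _ (fun b hb => (ha b hb).le) haS, List.map_cons, listDeriv,
      List.foldr_cons, ← listDeriv]
    have h1 : ∀ᶠ q : W × W in 𝓝 (x, x), ∀ J ∈ S.powerset,
        AnalyticAt ℂ (pdSet W J A) q.1 ∧ AnalyticAt ℂ (pdSet W (S \ J) B) q.2 := by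
      refine (Finset.eventually_all _).mpr fun J _ => ?_
      exact (continuousAt_fst.eventually (analyticAt_pdSet hA J).eventually_analyticAt).and
        (continuousAt_snd.eventually (analyticAt_pdSet hB (S \ J)).eventually_analyticAt)
    filter_upwards [ih.eventually_nhds, h1] with q hq hq1
    rw [EventuallyEq.fderiv_eq hq]
    have hd : HasFDerivAt (fun q : W × W => ∑ J ∈ S.powerset,
        t ^ J.card * pdSet W J A q.1 * pdSet W (S \ J) B q.2)
        (∑ J ∈ S.powerset, ((t ^ J.card * pdSet W J A q.1) •
            ((fderiv ℂ (pdSet W (S \ J) B) q.2).comp (ContinuousLinearMap.snd ℂ W W)) +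
          pdSet W (S \ J) B q.2 • (t ^ J.card •
            ((fderiv ℂ (pdSet W J A) q.1).comp (ContinuousLinearMap.fst ℂ W W))))) q := by
      refine HasFDerivAt.fun_sum fun J hJ => ?_
      have hA' : HasFDerivAt (fun q : W × W => pdSet W J A q.1) _ q :=
        (hq1 J hJ).1.differentiableAt.hasFDerivAt.comp q hasFDerivAt_fst
      have hB' : HasFDerivAt (fun q : W × W => pdSet W (S \ J) B q.2) _ q :=
        (hq1 J hJ).2.differentiableAt.hasFDerivAt.comp q hasFDerivAt_snd
      exact (hA'.const_mul _).mul hB'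
    rw [hd.fderiv, Finset.sum_powerset_insert haS, ← Finset.sum_add_distrib,
      sum_apply]
    refine Finset.sum_congr rfl fun J hJ => ?_
    have hJS := Finset.mem_powerset.mp hJ
    have haJ : a ∉ J := fun h => haS (hJS h)
    rw [Finset.insert_sdiff_of_notMem _ haJ, Finset.insert_sdiff_insert,
      Finset.sdiff_insert_of_notMem haS, Finset.card_insert_of_notMem haJ,
      pdSet_insert fun b hb => ha b (hJS hb),
      pdSet_insert fun b hb => ha b (Finset.sdiff_subset hb)]
    have e1 : pd W a (pdSet W J A) q.1 = fderiv ℂ (pdSet W J A) q.1 (dir W a) :=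
      (hq1 J hJ).1.differentiableAt.lineDeriv_eq_fderiv
    have e2 : pd W a (pdSet W (S \ J) B) q.2 = fderiv ℂ (pdSet W (S \ J) B) q.2 (dir W a) :=
      (hq1 J hJ).2.differentiableAt.lineDeriv_eq_fderiv
    rw [e1, e2]
    simp
    ring

lemma ofFn_comp_orderEmbOfFin {α : Type*} (v : Fin n → α) {m : ℕ} (S : Finset (Fin n))
    (hS : S.card = m) :
    List.ofFn (fun i => v (S.orderEmbOfFin hS i)) = S.sort.map v := by
  apply List.ext_getElem
  · simp [hS]
  · intro i h1 h2
    simp [Finset.orderEmbOfFin_apply]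

lemma iteratedFDeriv_mul_apply_sort {A B : W → ℂ} {x : W} (hA : AnalyticAt ℂ A x)
    (hB : AnalyticAt ℂ B x) (t : ℂ) {m : ℕ} (S : Finset (Fin n)) (hS : S.card = m) :
    iteratedFDeriv ℂ m (fun q : W × W => A q.1 * B q.2) (x, x)
        (fun i => (t • dir W (S.orderEmbOfFin hS i), dir W (S.orderEmbOfFin hS i))) =
      ∑ J ∈ S.powerset, t ^ J.card * pdSet W J A x * pdSet W (S \ J) B x := by
  have hAB : AnalyticAt ℂ (fun q : W × W => A q.1 * B q.2) (x, x) :=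
    (hA.fun_comp (f := Prod.fst) analyticAt_fst).mul (hB.fun_comp (f := Prod.snd) analyticAt_snd)
  have := (iteratedFDeriv_eventuallyEq_listDeriv hAB (fun i : Fin m =>
    (t • dir W (S.orderEmbOfFin hS i), dir W (S.orderEmbOfFin hS i)))).self_of_nhds
  dsimp only at this
  rw [this, ofFn_comp_orderEmbOfFin (fun i => (t • dir W i, dir W i)),
    (listDeriv_mul_eventuallyEq hA hB t S).self_of_nhds]

/-! ### Inclusion–exclusion -/

/-- Since `C(n-p, j) C(n-p-j, n-d) = C(n-p, n-d) C(d-p, j)`, the sum is `C(n-p, n-d)` times the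
forward difference of order `d - p` of `r ↦ r ^ k` at `p`. It vanishes for `k < d - p` and is `k!`
for `k = d - p`. -/
lemma sum_choose_mul_pow {n d k p : ℕ} (hd : d ≤ n) (hp : p + k ≤ d) :
    ∑ j ∈ Finset.range (n - p + 1), ((n - p).choose j : ℂ) *
        ((-1) ^ (d - (p + j)) * ((n - (p + j)).choose (n - d) : ℂ) * ((p + j : ℕ) : ℂ) ^ k) =
      if p + k = d then ((n - d + k).choose k : ℂ) * k.factorial else 0 := by
  have hsub : Finset.range (d - p + 1) ⊆ Finset.range (n - p + 1) :=
    Finset.range_subset_range.mpr (by omega)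
  rw [← Finset.sum_subset hsub]
  · have h1 : ∀ j ∈ Finset.range (d - p + 1), ((n - p).choose j : ℂ) *
        ((-1) ^ (d - (p + j)) * ((n - (p + j)).choose (n - d) : ℂ) * ((p + j : ℕ) : ℂ) ^ k) =
        ((n - p).choose (n - d) : ℂ) * (((-1 : ℤ) ^ (d - p - j) * (d - p).choose j) •
          ((p : ℂ) + j • 1) ^ k) := by
      intro j hj
      have hj' : j ≤ d - p := by simpa [Nat.lt_succ_iff] using hj
      have hc : (n - p).choose j * (n - (p + j)).choose (n - d) =
          (n - p).choose (n - d) * (d - p).choose j := by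
        have h := Nat.choose_mul (n := n - p) (k := n - p - j) (s := n - d) (by omega)
        rw [Nat.choose_symm (show j ≤ n - p by omega), show n - p - j = n - (p + j) by omega,
          show n - p - (n - d) = d - p by omega, show n - (p + j) - (n - d) = d - p - j by omega,
          Nat.choose_symm hj'] at h
        exact h
      have hc' : ((n - p).choose j : ℂ) * ((n - (p + j)).choose (n - d) : ℂ) =
          ((n - p).choose (n - d) : ℂ) * ((d - p).choose j : ℂ) := by exact_mod_cast hc
      rw [show d - (p + j) = d - p - j by omega, zsmul_eq_mul]
      push_cast
      simp only [nsmul_eq_mul, mul_one]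
      linear_combination (-1) ^ (d - p - j) * ((p : ℂ) + j) ^ k * hc'
    rw [Finset.sum_congr rfl h1, ← Finset.mul_sum,
      ← fwdDiff_iter_eq_sum_shift (1 : ℂ) (fun r : ℂ => r ^ k) (d - p) (p : ℂ)]
    split_ifs with h
    · rw [show d - p = k by omega, fwdDiff_iter_eq_factorial, show n - d + k = n - p by omega,
        show n - d = n - p - k by omega, Nat.choose_symm (by omega)]
      simp
    · rw [fwdDiff_iter_pow_eq_zero_of_lt (by omega)]
      simp
  · intro j hj hj'
    simp only [Finset.mem_range, not_lt] at hj hj'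
    rw [Nat.choose_eq_zero_of_lt (show n - (p + j) < n - d by omega)]
    simp

lemma sum_superset_apply_card {α : Type*} [AddCommMonoid α] {n : ℕ} (I : Finset (Fin n))
    (φ : ℕ → α) :
    ∑ K : Finset (Fin n) with I ⊆ K, φ K.card =
      ∑ j ∈ Finset.range (n - I.card + 1), (n - I.card).choose j • φ (I.card + j) := by
  have hc : (Iᶜ).card = n - I.card := by rw [Finset.card_compl, Fintype.card_fin]
  rw [← hc, ← Finset.sum_powerset_apply_card (fun j => φ (I.card + j))]
  refine Finset.sum_bij' (fun K _ => K \ I) (fun L _ => I ∪ L) ?_ ?_ ?_ ?_ ?_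
  · intro K _
    rw [Finset.mem_powerset]
    intro a ha
    simp at ha ⊢
    exact ha.2
  · intro L _; simp
  · intro K hK
    simp only [Finset.mem_filter, Finset.mem_univ, true_and] at hK
    simp [hK]
  · intro L hL
    rw [Finset.mem_powerset] at hL
    rw [Finset.union_sdiff_cancel_left]
    exact Finset.disjoint_left.mpr fun a ha hb => by simpa [ha] using hL hb
  · intro K hK
    simp only [Finset.mem_filter, Finset.mem_univ, true_and] at hK
    rw [Finset.card_sdiff_of_subset hK, Nat.add_sub_cancel' (Finset.card_le_card hK)]

/-- Recovering elementary symmetric expressions from powers of partial sums. -/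
lemma sum_multilinear_partialSums {E : Type*} [NormedAddCommGroup E] [NormedSpace ℂ E]
    {n d k m : ℕ} (hd : d ≤ n) (hm : m + k = d)
    (T : ContinuousMultilinearMap ℂ (fun _ : Fin m => E) ℂ)
    (hT : ∀ (v : Fin m → E) (π : Equiv.Perm (Fin m)), T (v ∘ π) = T v) (ξ : Fin n → E) :
    ∑ k' ∈ Finset.range (d + 1), (-1) ^ (d - k') * ((n - k').choose (n - d) : ℂ) *
        (k' : ℂ) ^ k * ∑ K ∈ Finset.powersetCard k' (Finset.univ : Finset (Fin n)),
          T (fun _ => ∑ i ∈ K, ξ i) =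
      ((n - d + k).choose k : ℂ) * k.factorial * m.factorial *
        ∑ S : {S : Finset (Fin n) // S.card = m}, T (fun i => ξ (S.1.orderEmbOfFin S.2 i)) := by
  classical
  set φ : ℕ → ℂ := fun t => (-1) ^ (d - t) * ((n - t).choose (n - d) : ℂ) * (t : ℂ) ^ k with hφ
  have h1 : ∑ k' ∈ Finset.range (d + 1), (-1) ^ (d - k') * ((n - k').choose (n - d) : ℂ) *
        (k' : ℂ) ^ k * ∑ K ∈ Finset.powersetCard k' (Finset.univ : Finset (Fin n)),
          T (fun _ => ∑ i ∈ K, ξ i) =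
      ∑ K : Finset (Fin n), φ K.card * T (fun _ => ∑ i ∈ K, ξ i) := by
    have hsub : Finset.range (d + 1) ⊆ Finset.range (n + 1) :=
      Finset.range_subset_range.mpr (by omega)
    rw [Finset.sum_subset hsub]
    · rw [← Finset.powerset_univ, Finset.sum_powerset, Finset.card_univ, Fintype.card_fin]
      refine Finset.sum_congr rfl fun k' _ => ?_
      rw [Finset.mul_sum]
      refine Finset.sum_congr rfl fun K hK => ?_
      rw [(Finset.mem_powersetCard.mp hK).2]
    · intro j hj hj'
      simp only [Finset.mem_range, not_lt] at hj hj'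
      rw [Nat.choose_eq_zero_of_lt (show n - j < n - d by omega)]
      simp
  -- By multilinearity this is a sum over index maps `r` into `K`. After exchanging the sums, the
  -- total weight of `r` runs over the supersets of its image.
  have h2 : ∀ K : Finset (Fin n), T (fun _ => ∑ i ∈ K, ξ i) =
      ∑ r : Fin m → Fin n, if Finset.univ.image r ⊆ K then T (fun i => ξ (r i)) else 0 := by
    intro K
    rw [T.map_sum_finset (fun _ i => ξ i) (fun _ => K), ← Finset.sum_filter]
    refine Finset.sum_congr ?_ fun _ _ => rfl
    ext r
    simp [Fintype.mem_piFinset, Finset.image_subset_iff]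
  rw [h1]
  simp_rw [h2, Finset.mul_sum]
  rw [Finset.sum_comm]
  have h3 : ∀ r : Fin m → Fin n,
      ∑ K : Finset (Fin n), φ K.card * (if Finset.univ.image r ⊆ K then T (fun i => ξ (r i))
        else 0) = if Function.Injective r then
          ((n - d + k).choose k : ℂ) * k.factorial * T (fun i => ξ (r i)) else 0 := by
    intro r
    simp_rw [mul_ite, mul_zero]
    rw [← Finset.sum_filter, ← Finset.sum_mul, sum_superset_apply_card]
    -- The image has at most `m = d - k` elements, and the weight vanishes for fewer: only injective
    -- `r` survive.
    have hle : (Finset.univ.image r).card ≤ m := by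
      simpa using Finset.card_image_le (s := Finset.univ) (f := r)
    simp_rw [nsmul_eq_mul, hφ]
    rw [sum_choose_mul_pow hd (by omega)]
    have hiff : (Finset.univ.image r).card + k = d ↔ Function.Injective r := by
      rw [← hm, add_left_inj]
      constructor
      · intro h
        have := Finset.card_image_iff.mp (by simpa using h :
          (Finset.univ.image r).card = (Finset.univ : Finset (Fin m)).card)
        simpa [Set.injOn_univ] using this
      · intro h
        rw [Finset.card_image_of_injective _ h, Finset.card_univ, Fintype.card_fin]
    simp_rw [hiff]
    split_ifs <;> simp
  simp_rw [h3]
  rw [← Finset.sum_filter, sum_injective_eq_sum_orderEmb]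
  refine Finset.sum_congr rfl fun S _ => ?_
  have h4 : ∀ π : Equiv.Perm (Fin m), T (fun i => ξ ((S.1.orderEmbOfFin S.2 ∘ π) i)) =
      T (fun i => ξ (S.1.orderEmbOfFin S.2 i)) := fun π =>
    hT (fun i => ξ (S.1.orderEmbOfFin S.2 i)) π
  simp_rw [h4]
  rw [Finset.sum_const, Finset.card_univ, Fintype.card_perm, Fintype.card_fin, nsmul_eq_mul]
  ring

/-! ### Expansion of the difference operators -/

lemma diffBar_eq (x : W) (i j : Fin n) :
    diffBar W x i j = ((EuclideanSpace.proj i - EuclideanSpace.proj j :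
      EuclideanSpace ℂ (Fin n) →L[ℂ] ℂ).comp W.subtypeL) x := by
  simp [diffBar, pairBar]

lemma analyticAt_Delta {τ : ℂ} (hτ : 0 < τ.im) (x : W) : AnalyticAt ℂ (Delta W τ) x := by
  refine Finset.analyticAt_fun_prod _ fun i _ => Finset.analyticAt_fun_prod _ fun j _ => ?_
  simp_rw [diffBar_eq]
  exact ((differentiable_theta hτ).analyticAt _).fun_comp (ContinuousLinearMap.analyticAt _ x)

lemma Delta_ne_zero {τ : ℂ} {x : W}
    (hx : ∀ i j : Fin n, i ≠ j → theta τ (diffBar W x i j) ≠ 0) : Delta W τ x ≠ 0 :=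
  Finset.prod_ne_zero_iff.mpr fun i _ => Finset.prod_ne_zero_iff.mpr fun j hj =>
    hx i j (Finset.mem_Ioi.mp hj).ne

lemma eventually_theta_mul_Delta_ne_zero {τ : ℂ} (hτ : 0 < τ.im) {u : ℂ} {x : W}
    (hu : theta τ u ≠ 0) (hx : Delta W τ x ≠ 0) {t : ℂ → ℂ} {y : ℂ → W} (ht : ContinuousAt t 0)
    (ht0 : t 0 = u) (hy : ContinuousAt y 0) (hy0 : y 0 = x) :
    ∀ᶠ h in 𝓝 0, theta τ (t h) * Delta W τ (y h) ≠ 0 := by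
  have h1 : ContinuousAt (fun h => theta τ (t h) * Delta W τ (y h)) 0 := by
    refine ContinuousAt.mul ?_ ?_
    · exact (differentiable_theta hτ).continuous.continuousAt.comp ht
    · exact ContinuousAt.comp (g := Delta W τ) (analyticAt_Delta hτ _).continuousAt hy
  refine h1.eventually_ne ?_
  rw [ht0, hy0]
  exact mul_ne_zero hu hx

/-- For small steps `Ṁ_d` is given by its explicit form, also at base points depending on the
step. -/
lemma eventually_Mdot_eq (hn : n ≠ 0) (hW : W = weightSpace n ∨ W = ⊤) {τ : ℂ} (hτ : 0 < τ.im)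
    (c : ℂ) {u : ℂ} (hu : theta τ u ≠ 0) {x : W} (hx : Delta W τ x ≠ 0) {y : ℂ → W}
    (hy : ContinuousAt y 0) (hy0 : y 0 = x) (d : ℕ) :
    ∀ᶠ h in 𝓝 0, ∀ f : W → ℂ, Mdot W τ c h u d f (y h) =
      ∑ K ∈ Finset.powersetCard d (Finset.univ : Finset (Fin n)),
        Delta W τ (y h - (c / n * h) • ∑ i ∈ K, dir W i) / Delta W τ (y h) *
          f (y h + h • ∑ i ∈ K, dir W i) := by
  have h1 : ∀ᶠ h in 𝓝 0, ∀ (k : Fin d → Fin n) (r : Fin d), theta τ (u - (r : ℕ) * h) *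
      Delta W τ (y h + h • ∑ s : Fin d, if (s : ℕ) < r then dir W (k s) else 0) ≠ 0 := by
    refine eventually_all.mpr fun k => eventually_all.mpr fun r => ?_
    refine eventually_theta_mul_Delta_ne_zero hτ hu hx (by fun_prop) (by simp) ?_ (by simp [hy0])
    exact hy.add (by fun_prop)
  have h2 : ∀ᶠ h in 𝓝 0, ∀ K : Finset (Fin n), theta τ (u + K.card * (c / n * h)) *
      Delta W τ (y h - (c / n * h) • ∑ i ∈ K, dir W i) ≠ 0 := by
    refine eventually_all.mpr fun K => ?_
    refine eventually_theta_mul_Delta_ne_zero hτ hu hx (by fun_prop) (by simp) ?_ (by simp [hy0])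
    exact hy.sub (by fun_prop)
  filter_upwards [h1, h2] with h hh1 hh2 f
  exact Mdot_eq_sum hn hW hτ c h u d f (y h) hh1 hh2

/-- The function whose line derivatives give the expansion of the difference operators. -/
def doubled (τ : ℂ) (f : W → ℂ) : W × W → ℂ := fun q => Delta W τ q.1 * f q.2

lemma analyticAt_doubled {τ : ℂ} (hτ : 0 < τ.im) {f : W → ℂ} {x : W} (hf : AnalyticAt ℂ f x) :
    AnalyticAt ℂ (doubled τ f) (x, x) :=
  ((analyticAt_Delta hτ x).fun_comp (f := Prod.fst) analyticAt_fst).mul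
    (hf.fun_comp (f := Prod.snd) analyticAt_snd)

lemma Mdot_eventuallyEq (hn : n ≠ 0) (hW : W = weightSpace n ∨ W = ⊤) {τ : ℂ} (hτ : 0 < τ.im)
    (c : ℂ) {u : ℂ} (hu : theta τ u ≠ 0) {x : W} (hx : Delta W τ x ≠ 0) (f : W → ℂ) (d : ℕ) :
    (fun h => Mdot W τ c h u d f x) =ᶠ[𝓝 0] fun h =>
      ∑ K ∈ Finset.powersetCard d (Finset.univ : Finset (Fin n)), (Delta W τ x)⁻¹ *
        doubled τ f ((x, x) + h • ∑ i ∈ K, (-(c / n) • dir W i, dir W i)) := by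
  filter_upwards [eventually_Mdot_eq hn hW hτ c hu hx (y := fun _ => x) continuousAt_const rfl d]
    with h hh
  rw [hh]
  refine Finset.sum_congr rfl fun K _ => ?_
  have h1 : ((x, x) + h • ∑ i ∈ K, (-(c / n) • dir W i, dir W i) : W × W) =
      (x - (c / n * h) • ∑ i ∈ K, dir W i, x + h • ∑ i ∈ K, dir W i) := by
    ext1
    · simp only [Prod.fst_add, Prod.smul_fst, Prod.fst_sum, ← Finset.smul_sum, smul_smul]
      rw [mul_neg, neg_smul, sub_eq_add_neg, mul_comm]
    · simp [Prod.snd_sum]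
  rw [h1, doubled]
  ring

lemma analyticAt_doubled_line {τ : ℂ} (hτ : 0 < τ.im) {f : W → ℂ} {x : W}
    (hf : AnalyticAt ℂ f x) (ξ : W × W) :
    AnalyticAt ℂ (fun h : ℂ => doubled τ f ((x, x) + h • ξ)) 0 := by
  have hl : AnalyticAt ℂ (fun h : ℂ => (x, x) + h • ξ) 0 :=
    analyticAt_const.add (analyticAt_id.smul analyticAt_const)
  exact AnalyticAt.fun_comp (by simpa using analyticAt_doubled hτ hf) hl

lemma analyticAt_Mdot (hn : n ≠ 0) (hW : W = weightSpace n ∨ W = ⊤) {τ : ℂ} (hτ : 0 < τ.im)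
    (c : ℂ) {u : ℂ} (hu : theta τ u ≠ 0) {x : W} (hx : Delta W τ x ≠ 0) {f : W → ℂ}
    (hf : AnalyticAt ℂ f x) (d : ℕ) :
    AnalyticAt ℂ (fun h => Mdot W τ c h u d f x) 0 := by
  refine AnalyticAt.congr ?_ (Mdot_eventuallyEq hn hW hτ c hu hx f d).symm
  exact Finset.analyticAt_fun_sum _ fun K _ =>
    analyticAt_const.mul (analyticAt_doubled_line hτ hf _)

lemma iteratedDeriv_Mdot (hn : n ≠ 0) (hW : W = weightSpace n ∨ W = ⊤) {τ : ℂ} (hτ : 0 < τ.im)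
    (c : ℂ) {u : ℂ} (hu : theta τ u ≠ 0) {x : W} (hx : Delta W τ x ≠ 0) {f : W → ℂ}
    (hf : AnalyticAt ℂ f x) (d m : ℕ) :
    iteratedDeriv m (fun h => Mdot W τ c h u d f x) 0 = (Delta W τ x)⁻¹ *
      ∑ K ∈ Finset.powersetCard d (Finset.univ : Finset (Fin n)),
        iteratedFDeriv ℂ m (doubled τ f) (x, x)
          (fun _ => ∑ i ∈ K, (-(c / n) • dir W i, dir W i)) := by
  rw [(Mdot_eventuallyEq hn hW hτ c hu hx f d).iteratedDeriv_eq, iteratedDeriv_fun_sum,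
    Finset.mul_sum]
  · refine Finset.sum_congr rfl fun K _ => ?_
    rw [iteratedDeriv_const_mul_field, iteratedDeriv_comp_line (analyticAt_doubled hτ hf)]
  · intro K _
    exact (analyticAt_const.mul (analyticAt_doubled_line hτ hf _)).contDiffAt

/-- In the Leibniz expansion each derivative of `Δ` carries `-(c/n)`; the prefactor cancels these
and leaves `-(n/c)` for each derivative of `f`. -/
lemma Dop_eq_sum_iteratedFDeriv (hn : n ≠ 0) {τ : ℂ} (hτ : 0 < τ.im) {c : ℂ} (hc : c ≠ 0)
    {f : W → ℂ} {x : W} (hf : AnalyticAt ℂ f x) (m : ℕ) :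
    Dop W τ c m f x = (-(n / c)) ^ m * (Delta W τ x)⁻¹ *
      ∑ S : {S : Finset (Fin n) // S.card = m}, iteratedFDeriv ℂ m (doubled τ f) (x, x)
        (fun i => (-(c / n) • dir W (S.1.orderEmbOfFin S.2 i),
          dir W (S.1.orderEmbOfFin S.2 i))) := by
  have hn' : (n : ℂ) ≠ 0 := by exact_mod_cast hn
  rw [Dop, Finset.sum_subtype (p := fun S : Finset (Fin n) => S.card = m) _ (by simp),
    Finset.mul_sum]
  refine Finset.sum_congr rfl fun S _ => ?_
  have := iteratedFDeriv_mul_apply_sort (analyticAt_Delta hτ x) hf (-(c / n)) S.1 S.2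
  rw [show (doubled τ f) = fun q : W × W => Delta W τ q.1 * f q.2 from rfl, this, Finset.mul_sum]
  refine Finset.sum_congr rfl fun J hJ => ?_
  have hJS := Finset.mem_powerset.mp hJ
  have hcard : (S.1 \ J).card + J.card = m := by
    rw [Finset.card_sdiff_add_card_eq_card hJS, S.2]
  have hinv : (-(n / c)) ^ J.card * (-(c / n)) ^ J.card = 1 := by
    rw [← mul_pow, neg_mul_neg, div_mul_div_cancel₀ hc, div_self hn', one_pow]
  have hpow : (-((n : ℂ) / c)) ^ m = (-(n / c)) ^ (S.1 \ J).card * (-(n / c)) ^ J.card := by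
    rw [← pow_add, hcard]
  rw [hpow]
  linear_combination (-(pdSet W J (Delta W τ) x * (Delta W τ x)⁻¹ *
    (-(n / c)) ^ (S.1 \ J).card * pdSet W (S.1 \ J) f x)) * hinv

theorem Dop_eq_sum_iteratedDeriv (hn : n ≠ 0) (hW : W = weightSpace n ∨ W = ⊤) {τ : ℂ}
    (hτ : 0 < τ.im) {c : ℂ} (hc : c ≠ 0) {u : ℂ} (hu : theta τ u ≠ 0) {x : W}
    (hx : Delta W τ x ≠ 0) {f : W → ℂ} (hf : AnalyticAt ℂ f x) {d k : ℕ} (hk : k ≤ d)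
    (hd : d ≤ n) :
    Dop W τ c (d - k) f x =
      (-(n / c)) ^ d / ((n - d + k).choose k : ℂ) *
        ∑ k' ∈ Finset.range (d + 1),
          (-1) ^ (d - k') * ((n - k').choose (n - d) : ℂ) *
            ((-(c * k' / n)) ^ k / (k.factorial : ℂ)) *
            (iteratedDeriv (d - k) (fun h : ℂ => Mdot W τ c h u k' f x) 0 /
              ((d - k).factorial : ℂ)) := by
  have hn' : (n : ℂ) ≠ 0 := by exact_mod_cast hn
  obtain ⟨m, rfl⟩ := Nat.exists_eq_add_of_le' hk
  rw [Nat.add_sub_cancel]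
  have hsym := sum_multilinear_partialSums hd rfl (iteratedFDeriv ℂ m (doubled τ f) (x, x))
    (fun v π => ((analyticAt_doubled hτ hf).contDiffAt).iteratedFDeriv_comp_perm v π)
    (fun i : Fin n => (-(c / n) • dir W i, dir W i))
  have hterm : ∀ k' ∈ Finset.range (m + k + 1),
      (-1) ^ (m + k - k') * ((n - k').choose (n - (m + k)) : ℂ) *
            ((-(c * k' / n)) ^ k / (k.factorial : ℂ)) *
            (iteratedDeriv m (fun h : ℂ => Mdot W τ c h u k' f x) 0 / (m.factorial : ℂ)) =
      (-(c / n)) ^ k * (Delta W τ x)⁻¹ / (k.factorial * m.factorial) *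
        ((-1) ^ (m + k - k') * ((n - k').choose (n - (m + k)) : ℂ) *
        (k' : ℂ) ^ k * ∑ K ∈ Finset.powersetCard k' (Finset.univ : Finset (Fin n)),
          iteratedFDeriv ℂ m (doubled τ f) (x, x)
            (fun _ => ∑ i ∈ K, (-(c / n) • dir W i, dir W i))) := by
    intro k' _
    rw [iteratedDeriv_Mdot hn hW hτ c hu hx hf,
      show -(c * k' / n) = -(c / n) * k' by ring, mul_pow]
    ring
  rw [Finset.sum_congr rfl hterm, ← Finset.mul_sum, hsym, Dop_eq_sum_iteratedFDeriv hn hτ hc hf]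
  have h1 : ((n - (m + k) + k).choose k : ℂ) ≠ 0 := by
    exact_mod_cast (Nat.choose_pos (Nat.le_add_left k _)).ne'
  have h2 : (k.factorial : ℂ) ≠ 0 := by exact_mod_cast k.factorial_ne_zero
  have h3 : (m.factorial : ℂ) ≠ 0 := by exact_mod_cast m.factorial_ne_zero
  have hinv : (-(n / c)) ^ k * (-(c / n)) ^ k = 1 := by
    rw [← mul_pow, neg_mul_neg, div_mul_div_cancel₀ hc, div_self hn', one_pow]
  generalize ∑ S : {S : Finset (Fin n) // S.card = m}, iteratedFDeriv ℂ m (doubled τ f) (x, x)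
        (fun i => (-(c / n) • dir W (S.1.orderEmbOfFin S.2 i),
          dir W (S.1.orderEmbOfFin S.2 i))) = Z
  generalize ((n - (m + k) + k).choose k : ℂ) = b at h1 ⊢
  rw [pow_add]
  generalize (-(n / c)) ^ k = p at hinv ⊢
  generalize (-(c / n)) ^ k = q at hinv ⊢
  generalize (-(n / c)) ^ m = s
  field_simp
  linear_combination (-(s * Z)) * hinv

end

/-! ### Second order expansion and the Calogero–Moser limit. -/

section

/-! ### Second order jets -/

/-- `F` is analytic at `0`, and its value and first two derivatives there are `a`, `b`, `c`. -/
def HasJet (F : ℂ → ℂ) (a b c : ℂ) : Prop :=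
  AnalyticAt ℂ F 0 ∧ F 0 = a ∧ deriv F 0 = b ∧ deriv (deriv F) 0 = c

namespace HasJet

variable {F G : ℂ → ℂ} {a b c a' b' c' : ℂ}

lemma congr (hF : HasJet F a b c) (h : G =ᶠ[𝓝 0] F) : HasJet G a b c :=
  ⟨hF.1.congr h.symm, h.self_of_nhds.trans hF.2.1, h.deriv_eq.trans hF.2.2.1,
    h.deriv.deriv_eq.trans hF.2.2.2⟩

lemma of_eq (hF : HasJet F a b c) (ha : a = a') (hb : b = b') (hc : c = c') :
    HasJet F a' b' c' := by
  subst ha hb hc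
  exact hF

lemma const (a : ℂ) : HasJet (fun _ => a) a 0 0 := by
  refine ⟨analyticAt_const, rfl, by simp, by simp⟩

lemma add (hF : HasJet F a b c) (hG : HasJet G a' b' c') :
    HasJet (fun h => F h + G h) (a + a') (b + b') (c + c') := by
  obtain ⟨hF, rfl, rfl, rfl⟩ := hF
  obtain ⟨hG, rfl, rfl, rfl⟩ := hG
  have h1 : deriv (fun h => F h + G h) =ᶠ[𝓝 0] fun h => deriv F h + deriv G h := by
    filter_upwards [hF.eventually_analyticAt, hG.eventually_analyticAt] with h hf hg
    exact deriv_fun_add hf.differentiableAt hg.differentiableAt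
  refine ⟨hF.add hG, rfl, h1.self_of_nhds, ?_⟩
  rw [h1.deriv_eq, deriv_fun_add hF.deriv.differentiableAt hG.deriv.differentiableAt]

lemma mul (hF : HasJet F a b c) (hG : HasJet G a' b' c') :
    HasJet (fun h => F h * G h) (a * a') (b * a' + a * b') (c * a' + 2 * b * b' + a * c') := by
  obtain ⟨hF, rfl, rfl, rfl⟩ := hF
  obtain ⟨hG, rfl, rfl, rfl⟩ := hG
  have h1 : deriv (fun h => F h * G h) =ᶠ[𝓝 0] fun h => deriv F h * G h + F h * deriv G h := by
    filter_upwards [hF.eventually_analyticAt, hG.eventually_analyticAt] with h hf hg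
    exact deriv_fun_mul hf.differentiableAt hg.differentiableAt
  refine ⟨hF.mul hG, rfl, h1.self_of_nhds, ?_⟩
  rw [h1.deriv_eq, deriv_fun_add (hF.deriv.fun_mul hG).differentiableAt
    (hF.fun_mul hG.deriv).differentiableAt,
    deriv_fun_mul hF.deriv.differentiableAt hG.differentiableAt,
    deriv_fun_mul hF.differentiableAt hG.deriv.differentiableAt]
  ring

lemma const_mul (k : ℂ) (hF : HasJet F a b c) : HasJet (fun h => k * F h) (k * a) (k * b) (k * c) :=
  ((const k).mul hF).of_eq rfl (by ring) (by ring)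

lemma sub (hF : HasJet F a b c) (hG : HasJet G a' b' c') :
    HasJet (fun h => F h - G h) (a - a') (b - b') (c - c') := by
  have := (hF.add (hG.const_mul (-1))).of_eq (a' := a - a') (b' := b - b') (c' := c - c')
    (by ring) (by ring) (by ring)
  refine this.congr (Eventually.of_forall fun h => ?_)
  ring

lemma exp (hF : HasJet F a b c) :
    HasJet (fun h => Complex.exp (F h)) (Complex.exp a) (Complex.exp a * b)
      (Complex.exp a * (c + b ^ 2)) := by
  obtain ⟨hF, rfl, rfl, rfl⟩ := hF
  have h1 : deriv (fun h => Complex.exp (F h)) =ᶠ[𝓝 0] fun h => Complex.exp (F h) * deriv F h := by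
    filter_upwards [hF.eventually_analyticAt] with h hf
    exact hf.differentiableAt.hasDerivAt.cexp.deriv
  refine ⟨hF.cexp, rfl, h1.self_of_nhds, ?_⟩
  rw [h1.deriv_eq, deriv_fun_mul hF.differentiableAt.cexp hF.deriv.differentiableAt,
    h1.self_of_nhds]
  ring

lemma sum {ι : Type*} (s : Finset ι) {F : ι → ℂ → ℂ} {a b c : ι → ℂ}
    (hF : ∀ i ∈ s, HasJet (F i) (a i) (b i) (c i)) :
    HasJet (fun h => ∑ i ∈ s, F i h) (∑ i ∈ s, a i) (∑ i ∈ s, b i) (∑ i ∈ s, c i) := by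
  classical
  induction s using Finset.induction_on with
  | empty => simpa using const 0
  | insert i s hi ih =>
    simp only [Finset.sum_insert hi]
    exact (hF i (Finset.mem_insert_self i s)).add
      (ih fun j hj => hF j (Finset.mem_insert_of_mem hj))

lemma tendsto_div_sq (hF : HasJet F 0 0 c) : Tendsto (fun h => F h / h ^ 2) (𝓝[≠] 0) (𝓝 (c / 2)) := by
  obtain ⟨hF, h0, h1, h2⟩ := hF
  obtain ⟨R, hR, hFR⟩ := hF.exists_eq_sum_add_pow_mul 3
  have hlim : Tendsto (fun h => c / 2 + h * R h) (𝓝[≠] 0) (𝓝 (c / 2)) := by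
    have : ContinuousAt (fun h => c / 2 + h * R h) 0 :=
      continuousAt_const.add (continuousAt_id.mul hR.continuousAt)
    have ht : Tendsto (fun h => c / 2 + h * R h) (𝓝 0) (𝓝 (c / 2 + 0 * R 0)) := this
    rw [zero_mul, add_zero] at ht
    exact ht.mono_left nhdsWithin_le_nhds
  refine hlim.congr' ?_
  filter_upwards [self_mem_nhdsWithin] with h hh
  have hh : h ≠ 0 := hh
  have h2' : iteratedDeriv 2 F 0 = c := by
    rw [iteratedDeriv_succ, iteratedDeriv_one, h2]
  rw [hFR h]
  simp only [Finset.sum_range_succ, Finset.sum_range_zero, iteratedDeriv_zero, iteratedDeriv_one,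
    h0, h1, h2', smul_eq_mul, mul_zero, zero_add, Nat.factorial]
  field_simp
  push_cast
  ring

end HasJet

lemma hasJet_line {E : Type*} [NormedAddCommGroup E] [NormedSpace ℂ E] {F : E → ℂ} {p : E}
    (hF : AnalyticAt ℂ F p) (ξ : E) :
    HasJet (fun h : ℂ => F (p + h • ξ)) (F p) (fderiv ℂ F p ξ) (fderiv ℂ (fderiv ℂ F) p ξ ξ) := by
  have hl : AnalyticAt ℂ (fun h : ℂ => p + h • ξ) 0 :=
    analyticAt_const.add (analyticAt_id.smul analyticAt_const)
  refine ⟨AnalyticAt.fun_comp (by simpa using hF) hl, by simp, ?_, ?_⟩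
  · rw [← iteratedDeriv_one, iteratedDeriv_comp_line hF, iteratedFDeriv_one_apply]
  · rw [← iteratedDeriv_one (f := fun h : ℂ => F (p + h • ξ)), ← iteratedDeriv_succ,
      iteratedDeriv_comp_line hF, iteratedFDeriv_two_apply]

variable {n : ℕ} {W : Submodule ℂ (EuclideanSpace ℂ (Fin n))}

lemma pd_pd_eq_deriv_deriv (i : Fin n) (F : W → ℂ) (x : W) :
    pd W i (pd W i F) x = deriv (deriv fun t : ℂ => F (x + t • dir W i)) 0 := by
  have h : (fun t : ℂ => pd W i F (x + t • dir W i)) = deriv fun t : ℂ => F (x + t • dir W i) := by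
    ext t
    rw [pd, lineDeriv]
    have := deriv_comp_const_add (f := fun s : ℂ => F (x + s • dir W i)) t 0
    rw [add_zero] at this
    rw [← this]
    congr 1
    ext s
    rw [add_smul, add_assoc]
  rw [← h]
  rfl

/-! ### The logarithm of `Δ` -/

/-- Dividing by the value at `x` brings the argument near `1`, away from the cut of the principal
logarithm. -/
lemma exists_isLogDelta {τ : ℂ} (hτ : 0 < τ.im) {x : W} (hx : Delta W τ x ≠ 0) :
    ∃ l : W → ℂ, IsLogDelta W τ l x := by
  have hD := analyticAt_Delta hτ x
  refine ⟨fun y => Complex.log (Delta W τ y / Delta W τ x) + Complex.log (Delta W τ x), ?_, ?_⟩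
  · refine AnalyticAt.add (AnalyticAt.clog (hD.div analyticAt_const hx) ?_) analyticAt_const
    simp [div_self hx]
  · filter_upwards [hD.continuousAt.eventually_ne hx] with y hy
    rw [Complex.exp_add, Complex.exp_log (div_ne_zero hy hx), Complex.exp_log hx,
      div_mul_cancel₀ _ hx]

lemma diffBar_add_smul (x y : W) (h : ℂ) (i j : Fin n) :
    diffBar W (x + h • y) i j = diffBar W x i j + h * diffBar W y i j := by
  simp only [diffBar, pairBar_add_smul]
  ring

/-- The Hessian of `log Δ`. -/
lemma fderiv_fderiv_logDelta {τ : ℂ} (hτ : 0 < τ.im) {x : W}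
    (hx : ∀ i j : Fin n, i ≠ j → theta τ (diffBar W x i j) ≠ 0) {l : W → ℂ}
    (hl : IsLogDelta W τ l x) (y : W) :
    fderiv ℂ (fderiv ℂ l) x y y = ∑ i : Fin n, ∑ j ∈ Finset.Ioi i,
      diffBar W y i j ^ 2 * deriv (logDeriv (theta τ)) (diffBar W x i j) := by
  have hθ := differentiable_theta hτ
  rw [← (hasJet_line hl.1 y).2.2.2]
  rw [Finset.sum_sigma' Finset.univ fun i : Fin n => Finset.Ioi i]
  have hline : Tendsto (fun h : ℂ => x + h • y) (𝓝 0) (𝓝 x) := by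
    have : Continuous fun h : ℂ => x + h • y := by fun_prop
    simpa using this.tendsto 0
  have hne : ∀ᶠ h : ℂ in 𝓝 0, ∀ p ∈ (Finset.univ : Finset (Fin n)).sigma fun i => Finset.Ioi i,
      theta τ (diffBar W x p.1 p.2 + h * diffBar W y p.1 p.2) ≠ 0 := by
    refine (Finset.eventually_all _).mpr fun p hp => ?_
    have hc : Continuous fun h : ℂ => theta τ (diffBar W x p.1 p.2 + h * diffBar W y p.1 p.2) :=
      hθ.continuous.comp (by fun_prop)
    refine hc.continuousAt.eventually_ne ?_
    simp only [Finset.mem_sigma, Finset.mem_univ, Finset.mem_Ioi, true_and] at hp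
    simpa using hx p.1 p.2 hp.ne
  -- The derivative of `l` along the line is the logarithmic derivative of `exp ∘ l = Δ`, a product
  -- of theta functions of affine arguments.
  have hderiv : deriv (fun h : ℂ => l (x + h • y)) =ᶠ[𝓝 0] fun h =>
      ∑ p ∈ (Finset.univ : Finset (Fin n)).sigma fun i => Finset.Ioi i,
        diffBar W y p.1 p.2 *
          logDeriv (theta τ) (diffBar W x p.1 p.2 + h * diffBar W y p.1 p.2) := by
    filter_upwards [(hline.eventually hl.2).eventually_nhds,
      (hasJet_line hl.1 y).1.eventually_analyticAt, hne] with h hexp han hh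
    have hexp' : (fun h : ℂ => cexp (l (x + h • y))) =ᶠ[𝓝 h] fun h =>
        ∏ p ∈ (Finset.univ : Finset (Fin n)).sigma fun i => Finset.Ioi i,
          theta τ (diffBar W x p.1 p.2 + h * diffBar W y p.1 p.2) := by
      filter_upwards [hexp] with s hs
      rw [hs, Delta, Finset.prod_sigma' Finset.univ fun i : Fin n => Finset.Ioi i]
      simp_rw [diffBar_add_smul]
    have h1 : logDeriv (fun h : ℂ => cexp (l (x + h • y))) h =
        deriv (fun h : ℂ => l (x + h • y)) h := by
      rw [logDeriv_apply, han.differentiableAt.hasDerivAt.cexp.deriv,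
        mul_div_cancel_left₀ _ (Complex.exp_ne_zero _)]
    have hlin : ∀ a b : ℂ, HasDerivAt (fun h : ℂ => a + h * b) b h := fun a b => by
      simpa using ((hasDerivAt_id h).mul_const b).const_add a
    have h2 := hexp'.self_of_nhds
    dsimp only at h2
    rw [← h1, logDeriv_apply, hexp'.deriv_eq, h2, ← logDeriv_apply (fun h =>
      ∏ p ∈ (Finset.univ : Finset (Fin n)).sigma fun i => Finset.Ioi i,
          theta τ (diffBar W x p.1 p.2 + h * diffBar W y p.1 p.2)), logDeriv_prod]
    · refine Finset.sum_congr rfl fun p _ => ?_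
      have := (hθ (diffBar W x p.1 p.2 + h * diffBar W y p.1 p.2)).hasDerivAt.comp h
        (hlin (diffBar W x p.1 p.2) (diffBar W y p.1 p.2))
      rw [logDeriv_apply, logDeriv_apply, show deriv (fun h : ℂ => theta τ
        (diffBar W x p.1 p.2 + h * diffBar W y p.1 p.2)) h = _ from this.deriv]
      ring
    · exact hh
    · intro p _
      exact (hθ _).comp h (hlin _ _).differentiableAt
  rw [hderiv.deriv_eq]
  refine HasDerivAt.deriv (HasDerivAt.fun_sum fun p hp => ?_)
  simp only [Finset.mem_sigma, Finset.mem_univ, Finset.mem_Ioi, true_and] at hp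
  have hlog : DifferentiableAt ℂ (logDeriv (theta τ)) (diffBar W x p.1 p.2) := by
    have h1 := (hθ.analyticAt (diffBar W x p.1 p.2))
    exact (h1.deriv.div h1 (hx _ _ hp.ne)).differentiableAt
  have hlin : HasDerivAt (fun h : ℂ => diffBar W x p.1 p.2 + h * diffBar W y p.1 p.2)
      (diffBar W y p.1 p.2) 0 := by
    simpa using ((hasDerivAt_id (0 : ℂ)).mul_const _).const_add (diffBar W x p.1 p.2)
  have h0 : diffBar W x p.1 p.2 + 0 * diffBar W y p.1 p.2 = diffBar W x p.1 p.2 := by ring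
  have := (HasDerivAt.comp (0 : ℂ) (h₂ := logDeriv (theta τ))
    (h := fun h : ℂ => diffBar W x p.1 p.2 + h * diffBar W y p.1 p.2)
    (by rw [h0]; exact hlog.hasDerivAt) hlin).const_mul (diffBar W y p.1 p.2)
  exact this.congr_deriv (by ring)

lemma diffBar_dir (hn : n ≠ 0) (hW : W = weightSpace n ∨ W = ⊤) (k i j : Fin n) :
    diffBar W (dir W k) i j = (if k = i then 1 else 0) - if k = j then 1 else 0 := by
  rw [diffBar, pairBar_dir hn hW, pairBar_dir hn hW]
  ring

/-- The Hessian form of `log Δ` vanishes on `∑ v_i`, which changes no difference of coordinates. So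
the off-diagonal sum is minus the trace, to which each pair `i < j` contributes twice, from `v_i`
and from `v_j`. -/
lemma sum_ne_fderiv_fderiv_logDelta (hn : n ≠ 0) (hW : W = weightSpace n ∨ W = ⊤) {τ : ℂ}
    (hτ : 0 < τ.im) {x : W}
    (hx : ∀ i j : Fin n, i ≠ j → theta τ (diffBar W x i j) ≠ 0) {l : W → ℂ}
    (hl : IsLogDelta W τ l x) :
    ∑ i : Fin n, ∑ j : Fin n, (if i = j then 0 else
        fderiv ℂ (fderiv ℂ l) x (dir W i) (dir W j)) =
      -2 * ∑ i : Fin n, ∑ j ∈ Finset.Ioi i, deriv (logDeriv (theta τ)) (diffBar W x i j) := by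
  set Q := fderiv ℂ (fderiv ℂ l) x
  have h1 : ∑ i : Fin n, ∑ j : Fin n, (if i = j then 0 else Q (dir W i) (dir W j)) =
      Q (∑ i, dir W i) (∑ i, dir W i) - ∑ i, Q (dir W i) (dir W i) := by
    rw [map_sum Q, sum_apply, ← Finset.sum_sub_distrib]
    refine Finset.sum_congr rfl fun i _ => ?_
    have h0 : Q (dir W i) (dir W i) = ∑ j, if i = j then Q (dir W i) (dir W j) else 0 := by simp
    rw [map_sum, h0, ← Finset.sum_sub_distrib]
    refine Finset.sum_congr rfl fun j _ => ?_
    split_ifs <;> simp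
  have h2 : Q (∑ i, dir W i) (∑ i, dir W i) = 0 := by
    rw [fderiv_fderiv_logDelta hτ hx hl]
    refine Finset.sum_eq_zero fun i _ => Finset.sum_eq_zero fun j _ => ?_
    have : diffBar W (∑ i, dir W i) i j = 0 := by
      rw [diffBar, pairBar_sum, pairBar_sum]
      simp [pairBar_dir hn hW]
    rw [this]
    simp
  rw [h1, h2]
  simp_rw [Q, fderiv_fderiv_logDelta hτ hx hl]
  rw [Finset.sum_comm, zero_sub, neg_mul, neg_inj, Finset.mul_sum]
  refine Finset.sum_congr rfl fun i _ => ?_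
  rw [Finset.sum_comm, Finset.mul_sum]
  refine Finset.sum_congr rfl fun j hj => ?_
  have hij : i ≠ j := (Finset.mem_Ioi.mp hj).ne
  rw [← Finset.sum_mul]
  congr 1
  have : ∀ k : Fin n, diffBar W (dir W k) i j ^ 2 =
      (if k = i then 1 else 0) + if k = j then 1 else 0 := by
    intro k
    rw [diffBar_dir hn hW]
    by_cases h : k = i
    · subst h; simp [hij]
    · simp [h]
  simp_rw [this]
  rw [Finset.sum_add_distrib]
  simp
  norm_num

/-! ### The Calogero–Moser limit -/

lemma sum_powersetCard_one {R : Type*} [AddCommMonoid R] (F : W → R) :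
    ∑ K ∈ Finset.powersetCard 1 (Finset.univ : Finset (Fin n)), F (∑ i ∈ K, dir W i) =
      ∑ i, F (dir W i) := by
  rw [Finset.powersetCard_one, Finset.sum_map]
  simp

lemma two_mul_sum_powersetCard_two (F : W → ℂ) :
    2 * ∑ K ∈ Finset.powersetCard 2 (Finset.univ : Finset (Fin n)), F (∑ i ∈ K, dir W i) =
      ∑ i, ∑ j, if i = j then 0 else F (dir W i + dir W j) := by
  have h := sum_injective_eq_sum_orderEmb (n := n) (d := 2) fun k => F (∑ s, dir W (k s))
  have h1 : ∀ (S : {S : Finset (Fin n) // S.card = 2}) (π : Equiv.Perm (Fin 2)),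
      ∑ s, dir W ((S.1.orderEmbOfFin S.2 ∘ π) s) = ∑ i ∈ S.1, dir W i := by
    intro S π
    simp only [Function.comp_apply]
    rw [Equiv.sum_comp π fun s => dir W (S.1.orderEmbOfFin S.2 s), ← Finset.sum_coe_sort S.1,
      ← (S.1.orderIsoOfFin S.2).toEquiv.sum_comp]
    rfl
  simp_rw [h1, Finset.sum_const, Finset.card_univ, Fintype.card_perm, Fintype.card_fin] at h
  rw [Finset.sum_subtype (p := fun S : Finset (Fin n) => S.card = 2) _ (by simp), Finset.mul_sum]
  simp only [nsmul_eq_mul, Nat.factorial, Nat.cast_ofNat, Nat.succ_eq_add_one, zero_add,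
    Nat.reduceAdd, mul_one] at h
  rw [← h, Finset.sum_filter, ← (finTwoArrowEquiv (Fin n)).symm.sum_comp, Fintype.sum_prod_type]
  refine Finset.sum_congr rfl fun i _ => Finset.sum_congr rfl fun j _ => ?_
  have hinj : Function.Injective ((finTwoArrowEquiv (Fin n)).symm (i, j)) ↔ ¬ i = j := by
    constructor
    · intro hi hij
      have := @hi 0 1 (by simpa using hij)
      simp at this
    · intro hij a b hab
      fin_cases a <;> fin_cases b <;> simp_all [eq_comm]
  simp only [hinj, ite_not]
  simp

/-- The jet of a term of `Ṁ_1²`. -/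
lemma hasJet_exp_logDelta_mul {l f : W → ℂ} {x : W} (hl : AnalyticAt ℂ l x)
    (hf : AnalyticAt ℂ f x) (y₁ y₂ y₃ z : W) :
    HasJet (fun h : ℂ => cexp (l (x + h • y₁) - l x + (l (x + h • y₂) - l (x + h • y₃))) *
        f (x + h • z)) (f x)
      ((fderiv ℂ l x y₁ + (fderiv ℂ l x y₂ - fderiv ℂ l x y₃)) * f x + fderiv ℂ f x z)
      ((fderiv ℂ (fderiv ℂ l) x y₁ y₁ + (fderiv ℂ (fderiv ℂ l) x y₂ y₂ -
          fderiv ℂ (fderiv ℂ l) x y₃ y₃) +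
          (fderiv ℂ l x y₁ + (fderiv ℂ l x y₂ - fderiv ℂ l x y₃)) ^ 2) * f x +
        2 * (fderiv ℂ l x y₁ + (fderiv ℂ l x y₂ - fderiv ℂ l x y₃)) * fderiv ℂ f x z +
        fderiv ℂ (fderiv ℂ f) x z z) := by
  have := ((((hasJet_line hl y₁).sub (HasJet.const (l x))).add
    ((hasJet_line hl y₂).sub (hasJet_line hl y₃))).exp).mul (hasJet_line hf z)
  refine this.of_eq ?_ ?_ ?_
  · simp
  · simp
  · simp

/-- With `g = c/n`, the terms of `Ṁ_1²` and `2 Ṁ_2` at an ordered pair `i ≠ j` differ only from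
second order on, by a multiple of the mixed derivative of `log Δ`. The diagonal of `Ṁ_1²` combines
with `-2 Ṁ_1 + n` into a second difference, whose limit is the conjugated Laplacian. -/
theorem tendsto_calogeroMoser (hn : n ≠ 0) (hW : W = weightSpace n ∨ W = ⊤) {τ : ℂ}
    (hτ : 0 < τ.im) (c : ℂ) {u : ℂ} (hu : theta τ u ≠ 0) {x : W}
    (hx : ∀ i j : Fin n, i ≠ j → theta τ (diffBar W x i j) ≠ 0) {f : W → ℂ}
    (hf : AnalyticAt ℂ f x) {l : W → ℂ} (hl : IsLogDelta W τ l x) :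
    Tendsto (fun h : ℂ =>
        (-2 * Mdot W τ c h u 2 f x + Mdot W τ c h u 1 (Mdot W τ c h u 1 f) x
          - 2 * Mdot W τ c h u 1 f x + n * f x) / h ^ 2)
      (𝓝[≠] 0) (𝓝 (Hop W τ c l f x)) := by
  have hΔ : Delta W τ x ≠ 0 := Delta_ne_zero hx
  set g : ℂ := c / n with hg
  set P : Fin n → ℂ := fun i => fderiv ℂ l x (dir W i) with hP
  set Q : Fin n → Fin n → ℂ := fun i j => fderiv ℂ (fderiv ℂ l) x (dir W i) (dir W j) with hQ
  have hsymm : ∀ i j, Q i j = Q j i := fun i j =>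
    (hl.1.contDiffAt (n := ⊤)).isSymmSndFDerivAt (by simp) (dir W i) (dir W j)
  -- the terms of the operators, in exponential form
  let A : Fin n → Fin n → ℂ → ℂ := fun i j h =>
    cexp (l (x + h • (-g • dir W i)) - l x +
      (l (x + h • (dir W i - g • dir W j)) - l (x + h • dir W i))) *
        f (x + h • (dir W i + dir W j))
  -- The vanishing difference at `0` in `B` and `C` gives them the shape of
  -- `hasJet_exp_logDelta_mul`.
  let B : Fin n → Fin n → ℂ → ℂ := fun i j h =>
    cexp (l (x + h • (-g • (dir W i + dir W j))) - l x +
      (l (x + h • (0 : W)) - l (x + h • (0 : W)))) * f (x + h • (dir W i + dir W j))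
  let C : Fin n → ℂ → ℂ := fun i h =>
    cexp (l (x + h • (-g • dir W i)) - l x +
      (l (x + h • (0 : W)) - l (x + h • (0 : W)))) * f (x + h • dir W i)
  have hline : ∀ y : W, Tendsto (fun h : ℂ => x + h • y) (𝓝 0) (𝓝 x) := by
    intro y
    have : Continuous fun h : ℂ => x + h • y := by fun_prop
    simpa using this.tendsto 0
  have hexp : ∀ y : W, ∀ᶠ h : ℂ in 𝓝 0, Delta W τ (x + h • y) = cexp (l (x + h • y)) := fun y =>
    (hline y).eventually (hl.2.mono fun _ h => h.symm)
  have hexp0 : Delta W τ x = cexp (l x) := hl.2.self_of_nhds.symm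
  have hev : (fun h : ℂ => -2 * Mdot W τ c h u 2 f x + Mdot W τ c h u 1 (Mdot W τ c h u 1 f) x
          - 2 * Mdot W τ c h u 1 f x + n * f x) =ᶠ[𝓝 0]
      fun h => ∑ i, ((∑ j, (A i j h - if i = j then 0 else B i j h)) - 2 * C i h + f x) := by
    -- For `Ṁ_1²` the outer operator acts on a function that itself depends on `h`, hence the
    -- uniformity in `f`; the inner one is evaluated at the moving points of `e3`.
    have e1 := eventually_Mdot_eq hn hW hτ c hu hΔ (y := fun _ => x) continuousAt_const rfl 1
    have e2 := eventually_Mdot_eq hn hW hτ c hu hΔ (y := fun _ => x) continuousAt_const rfl 2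
    have e3 : ∀ᶠ h : ℂ in 𝓝 0, ∀ i, ∀ f : W → ℂ, Mdot W τ c h u 1 f (x + h • dir W i) = _ :=
      eventually_all.mpr fun i => eventually_Mdot_eq hn hW hτ c hu hΔ
        (y := fun h => x + h • dir W i) (by fun_prop) (by simp) 1
    have d1 : ∀ᶠ h : ℂ in 𝓝 0, ∀ i, Delta W τ (x + h • (-g • dir W i)) = _ :=
      eventually_all.mpr fun i => hexp _
    have d2 : ∀ᶠ h : ℂ in 𝓝 0, ∀ i, Delta W τ (x + h • dir W i) = _ :=
      eventually_all.mpr fun i => hexp _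
    have d3 : ∀ᶠ h : ℂ in 𝓝 0, ∀ i j, Delta W τ (x + h • (dir W i - g • dir W j)) = _ :=
      eventually_all.mpr fun i => eventually_all.mpr fun j => hexp _
    have d4 : ∀ᶠ h : ℂ in 𝓝 0, ∀ i j, Delta W τ (x + h • (-g • (dir W i + dir W j))) = _ :=
      eventually_all.mpr fun i => eventually_all.mpr fun j => hexp _
    filter_upwards [e1, e2, e3, d1, d2, d3, d4] with h e1 e2 e3 d1 d2 d3 d4
    have s1 : ∀ y z : W, y - (g * h) • z = y + h • (-g • z) := by
      intro y z
      rw [smul_smul, mul_neg, neg_smul, sub_eq_add_neg, mul_comm]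
    have s2 : ∀ y z : W, x + h • y + h • z = x + h • (y + z) := by
      intro y z
      rw [smul_add, add_assoc]
    have m1 : Mdot W τ c h u 1 f x = ∑ i, C i h := by
      rw [e1, sum_powersetCard_one (fun v => Delta W τ (x - (g * h) • v) / Delta W τ x *
        f (x + h • v))]
      refine Finset.sum_congr rfl fun i _ => ?_
      simp only [C]
      rw [s1, d1, hexp0, sub_self, add_zero, Complex.exp_sub]
    have m2 : 2 * Mdot W τ c h u 2 f x = ∑ i, ∑ j, if i = j then 0 else B i j h := by
      rw [e2, two_mul_sum_powersetCard_two (fun v => Delta W τ (x - (g * h) • v) / Delta W τ x *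
        f (x + h • v))]
      refine Finset.sum_congr rfl fun i _ => Finset.sum_congr rfl fun j _ => ?_
      simp only [B]
      rw [s1, d4, hexp0, sub_self, add_zero, Complex.exp_sub]
    have m3 : Mdot W τ c h u 1 (Mdot W τ c h u 1 f) x = ∑ i, ∑ j, A i j h := by
      rw [e1, sum_powersetCard_one (fun v => Delta W τ (x - (g * h) • v) / Delta W τ x *
        Mdot W τ c h u 1 f (x + h • v))]
      refine Finset.sum_congr rfl fun i _ => ?_
      rw [e3 i f, sum_powersetCard_one (fun v => Delta W τ (x + h • dir W i - (g * h) • v) /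
        Delta W τ (x + h • dir W i) * f (x + h • dir W i + h • v)), Finset.mul_sum]
      refine Finset.sum_congr rfl fun j _ => ?_
      simp only [A]
      rw [s1, s1, s2, s2, d1, d2, neg_smul g (dir W j), ← sub_eq_add_neg, d3, hexp0,
        Complex.exp_add, Complex.exp_sub, Complex.exp_sub, neg_smul]
      ring
    rw [neg_mul, m2, m3, m1]
    simp only [Finset.sum_add_distrib, Finset.sum_sub_distrib, Finset.sum_const, Finset.card_univ,
      Fintype.card_fin, nsmul_eq_mul, ← Finset.mul_sum]
    ring
  have hjet : HasJet (fun h => ∑ i, ((∑ j, (A i j h - if i = j then 0 else B i j h))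
      - 2 * C i h + f x)) 0 0
      (∑ i, (∑ j, (if i = j then 0 else -2 * g * (g + 1) * Q i j * f x) +
        2 * (fderiv ℂ (fderiv ℂ f) x (dir W i) (dir W i)
          - 2 * g * P i * fderiv ℂ f x (dir W i) + (g ^ 2 * P i ^ 2 - g * Q i i) * f x))) := by
    have hterm : ∀ i ∈ (Finset.univ : Finset (Fin n)),
        HasJet (fun h => (∑ j, (A i j h - if i = j then 0 else B i j h)) - 2 * C i h + f x) 0 0
          (∑ j, (if i = j then 0 else -2 * g * (g + 1) * Q i j * f x) +
            2 * (fderiv ℂ (fderiv ℂ f) x (dir W i) (dir W i)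
              - 2 * g * P i * fderiv ℂ f x (dir W i) +
                (g ^ 2 * P i ^ 2 - g * Q i i) * f x)) := by
      intro i _
      have hC := hasJet_exp_logDelta_mul hl.1 hf (-g • dir W i) 0 0 (dir W i)
      have hAB : ∀ j ∈ (Finset.univ : Finset (Fin n)),
          HasJet (fun h => A i j h - if i = j then 0 else B i j h)
            (if i = j then f x else 0)
            (if i = j then -2 * g * P i * f x + 2 * fderiv ℂ f x (dir W i) else 0)
            ((if i = j then 0 else -2 * g * (g + 1) * Q i j * f x) +
              if i = j then ((2 * g ^ 2 - 2 * g) * Q i i + 4 * g ^ 2 * P i ^ 2) * f x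
                - 8 * g * P i * fderiv ℂ f x (dir W i)
                + 4 * fderiv ℂ (fderiv ℂ f) x (dir W i) (dir W i) else 0) := by
        intro j _
        have hA := hasJet_exp_logDelta_mul hl.1 hf (-g • dir W i) (dir W i - g • dir W j) (dir W i)
          (dir W i + dir W j)
        by_cases hij : i = j
        · subst hij
          simp only [if_true, sub_zero, zero_add]
          refine hA.of_eq rfl ?_ ?_
          · simp only [map_add, map_sub, map_smul, smul_eq_mul]
            simp only [hP]
            ring
          · simp only [map_add, map_sub, map_smul, smul_eq_mul, add_apply, sub_apply, smul_apply]
            simp only [hP, hQ]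
            ring
        · simp only [hij, if_false, add_zero]
          have hB := hasJet_exp_logDelta_mul hl.1 hf (-g • (dir W i + dir W j)) 0 0
            (dir W i + dir W j)
          refine (hA.sub hB).of_eq (sub_self _) ?_ ?_
          · simp only [map_add, map_sub, map_smul, smul_eq_mul, map_zero]
            ring
          · have hs := hsymm i j
            simp only [hQ] at hs
            simp only [map_add, map_sub, map_smul, smul_eq_mul, add_apply, sub_apply, smul_apply,
              map_zero, hQ]
            linear_combination (g ^ 2 + g) * f x * hs
      -- Below second order only `j = i` contributes to the sum over `j`: the values give `f - 2 f +
      -- f = 0`, and the first derivative of `A i i` is twice that of `C i`.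
      have h1 := ((HasJet.sum Finset.univ hAB).sub (hC.const_mul 2)).add (HasJet.const (f x))
      refine h1.of_eq ?_ ?_ ?_
      · simp only [Finset.sum_ite_eq, Finset.mem_univ, if_true]
        ring
      · simp only [Finset.sum_ite_eq, Finset.mem_univ, if_true, map_smul, smul_eq_mul, map_zero]
        simp only [hP]
        ring
      · rw [Finset.sum_add_distrib]
        simp only [Finset.sum_ite_eq, Finset.mem_univ, if_true, map_smul, smul_eq_mul, map_zero,
          smul_apply]
        simp only [hP, hQ]
        ring
    exact (HasJet.sum Finset.univ hterm).of_eq (by simp) (by simp) rfl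
  have hlim := (hjet.congr hev).tendsto_div_sq
  convert hlim using 2
  -- Conjugating `∂_i²` by `Δ^{-g}` yields exactly the diagonal part of the second order jet.
  have hpd : ∀ i, pd W i (pd W i fun y => cexp (-g * l y) * f y) x = cexp (-g * l x) *
      (fderiv ℂ (fderiv ℂ f) x (dir W i) (dir W i)
          - 2 * g * P i * fderiv ℂ f x (dir W i) + (g ^ 2 * P i ^ 2 - g * Q i i) * f x) := by
    intro i
    have hj := (((hasJet_line hl.1 (dir W i)).const_mul (-g)).exp).mul (hasJet_line hf (dir W i))
    rw [pd_pd_eq_deriv_deriv, hj.2.2.2]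
    simp only [hP, hQ]
    ring
  have hsum := sum_ne_fderiv_fderiv_logDelta hn hW hτ hx hl
  have hsum' : ∑ i, ∑ j, (if i = j then 0 else -2 * g * (g + 1) * Q i j * f x) =
      -2 * g * (g + 1) * f x * (-2 * ∑ i : Fin n, ∑ j ∈ Finset.Ioi i,
        deriv (logDeriv (theta τ)) (diffBar W x i j)) := by
    rw [← hsum, Finset.mul_sum]
    refine Finset.sum_congr rfl fun i _ => ?_
    rw [Finset.mul_sum]
    refine Finset.sum_congr rfl fun j _ => ?_
    split_ifs
    · simp
    · simp only [hQ]; ring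
  have hE : cexp (g * l x) * cexp (-g * l x) = 1 := by
    rw [← Complex.exp_add, neg_mul, add_neg_cancel, Complex.exp_zero]
  simp only [Hop]
  rw [← hg]
  simp_rw [hpd]
  have hsplit : ∀ S D : Fin n → ℂ, ∑ i, (S i + 2 * D i) = ∑ i, S i + 2 * ∑ i, D i := by
    intro S D
    rw [Finset.sum_add_distrib, Finset.mul_sum]
  rw [← Finset.mul_sum, hsplit, hsum']
  generalize ∑ i : Fin n, ∑ j ∈ Finset.Ioi i, deriv (logDeriv (theta τ)) (diffBar W x i j) = Z
  generalize ∑ i : Fin n, (fderiv ℂ (fderiv ℂ f) x (dir W i) (dir W i)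
          - 2 * g * P i * fderiv ℂ f x (dir W i) + (g ^ 2 * P i ^ 2 - g * Q i i) * f x) = Y
  linear_combination (Y + 2 * g * (g + 1) * Z * f x) * hE

end

end EllipticCM

end

theorem proposition5 (n : ℕ) (hn : 1 < n)
    (W : Submodule ℂ (EuclideanSpace ℂ (Fin n)))
    (hW : W = EllipticCM.weightSpace n ∨ W = ⊤)
    (τ : ℂ) (hτ : 0 < τ.im) (c u : ℂ) (hu : EllipticCM.theta τ u ≠ 0)
    (x : W) (hx : ∀ i j : Fin n, i ≠ j → EllipticCM.theta τ (EllipticCM.diffBar W x i j) ≠ 0)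
    (f : W → ℂ) (hf : AnalyticAt ℂ f x) :
    (∀ k' ≤ n, AnalyticAt ℂ (fun h : ℂ => EllipticCM.Mdot W τ c h u k' f x) 0) ∧
    (c ≠ 0 → ∀ d k : ℕ, k ≤ d → d ≤ n →
      EllipticCM.Dop W τ c (d - k) f x =
        (-(n / c)) ^ d / ((n - d + k).choose k : ℂ) *
          ∑ k' ∈ Finset.range (d + 1),
            (-1) ^ (d - k') * ((n - k').choose (n - d) : ℂ) *
              ((-(c * k' / n)) ^ k / (k.factorial : ℂ)) *
              (iteratedDeriv (d - k) (fun h : ℂ => EllipticCM.Mdot W τ c h u k' f x) 0 /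
                ((d - k).factorial : ℂ))) ∧
    (∃ l : W → ℂ, EllipticCM.IsLogDelta W τ l x) ∧
    (∀ l : W → ℂ, EllipticCM.IsLogDelta W τ l x →
      Tendsto (fun h : ℂ =>
          (-2 * EllipticCM.Mdot W τ c h u 2 f x
            + EllipticCM.Mdot W τ c h u 1 (EllipticCM.Mdot W τ c h u 1 f) x
            - 2 * EllipticCM.Mdot W τ c h u 1 f x + n * f x) / h ^ 2)
        (𝓝[≠] 0) (𝓝 (EllipticCM.Hop W τ c l f x))) := by
  have hn0 : n ≠ 0 := by omega
  have hΔ := EllipticCM.Delta_ne_zero hx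
  exact ⟨fun k' _ => EllipticCM.analyticAt_Mdot hn0 hW hτ c hu hΔ hf k',
    fun hc _ _ hk hd => EllipticCM.Dop_eq_sum_iteratedDeriv hn0 hW hτ hc hu hΔ hf hk hd,
    EllipticCM.exists_isLogDelta hτ hΔ,
    fun _ hl => EllipticCM.tendsto_calogeroMoser hn0 hW hτ c hu hx hf hl⟩
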